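/- Let $X$ be a separable real Hilbert space, $T>0$, and let $A:\mathcal D(A)\subseteq X\to X$ generate a $C_0$-semigroup $(e^{At})_{t\ge0}$ on $X$, with $(e^{At})^*=e^{A^*t}$. Assume that either $A^*=A$ or $A^*=-A$; in the second case $e^{At}$ is invertible and $e^{-At}$ denotes its inverse. For operator-valued functions on $[0,T]$, $L^\infty(0,T;\mathcal L(X))$ means strongly measurable and essentially bounded, and integrals are taken in the strong sense. Let $B_{ij}\in L^\infty(0,T;\mathcal L(X))$ ($i,j=1,2$), $b_0,g_0\in L^1(0,T;X)$, let $M,\bar M,\Theta,Q_0,\bar Q_0\in L^\infty(0,T;\mathcal L(X))$, and let $Q_0(t),\bar Q_0(t)$ be self-adjoint for all $t\in[0,T]$. Let $(y,\psi)$ be a mild solution of the linear forward-backward evolution equation $$\dot y=Ay+B_{11}y+B_{12}\psi+b_0,\qquad \dot\psi=-A^*\psi-B_{21}y-B_{22}\psi-g_0,\qquad y(0),\ \psi(T)\ \text{given},$$ that is, $y,\psi\in C([0,T];X)$ and for all $t\in[0,T]$ $$y(t)=e^{At}y(0)+\int_0^te^{A(t-s)}\big[B_{11}(s)y(s)+B_{12}(s)\psi(s)+b_0(s)\big]ds,$$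 $$\psi(t)=e^{A^*(T-t)}\psi(T)+\int_t^Te^{A^*(s-t)}\big[B_{21}(s)y(s)+B_{22}(s)\psi(s)+g_0(s)\big]ds.$$ On $X\times X$ put $$\mathbb A=\begin{pmatrix}A&0\\0&-A^*\end{pmatrix},\quad \mathbb B=\begin{pmatrix}B_{11}&B_{12}\\-B_{21}&-B_{22}\end{pmatrix},\quad \mathbb M=\begin{pmatrix}M&0\\0&-\bar M^*\end{pmatrix},\quad \mathbb Q=\begin{pmatrix}Q_0&\Theta^*\\ \Theta&\bar Q_0\end{pmatrix},\quad \Pi=\begin{pmatrix}P&\Gamma^*\\ \Gamma&\bar P\end{pmatrix},$$ and let $\Pi$ be a mild solution of the Lyapunov equation $\dot\Pi+\Pi(\mathbb A-\mathbb M)+(\mathbb A-\mathbb M)^*\Pi+\mathbb Q=0$ on $[0,T]$. This means that $P,\bar P,\Gamma:[0,T]\to\mathcal L(X)$ are strongly continuous, $P(t)$ and $\bar P(t)$ are self-adjoint, and for all $t\in[0,T]$ $$P(t)=e^{A^*(T-t)}P(T)e^{A(T-t)}-\int_t^Te^{A^*(s-t)}\big[P(s)M(s)+M(s)^*P(s)-Q_0(s)\big]e^{A(s-t)}ds,$$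 $$\bar P(t)=e^{At}\bar P(0)e^{A^*t}-\int_0^te^{A(t-s)}\big[\bar P(s)\bar M(s)^*+\bar M(s)\bar P(s)+\bar Q_0(s)\big]e^{A^*(t-s)}ds;$$ if $A^*=A$, then for all $t\in[0,T]$ the operator $\Gamma(t)$ maps $\mathcal D(A)$ into itself, $\Gamma(t)Ax=A\Gamma(t)x$ for $x\in\mathcal D(A)$, and $$\Gamma(t)=\Gamma(T)+\int_t^T\big[\bar M(s)\Gamma(s)-\Gamma(s)M(s)+\Theta(s)\big]ds;$$ if $A^*=-A$, then for all $t\in[0,T]$ $$\Gamma(t)=e^{-A(T-t)}\Gamma(T)e^{A(T-t)}+\int_t^Te^{-A(s-t)}\big[\bar M(s)\Gamma(s)-\Gamma(s)M(s)+\Theta(s)\big]e^{A(s-t)}ds.$$ Then, with $z(t)=\begin{pmatrix}y(t)\\ \psi(t)\end{pmatrix}$, the integrand below is integrable on $[0,T]$ and $$\langle\Pi(T)z(T),z(T)\rangle-\langle\Pi(0)z(0),z(0)\rangle$$ $$=\int_0^T\Big[\big\langle\big(\Pi(t)[\mathbb B(t)+\mathbb M(t)]+[\mathbb B(t)+\mathbb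 M(t)]^*\Pi(t)-\mathbb Q(t)\big)z(t),z(t)\big\rangle+2\Big\langle\Pi(t)\begin{pmatrix}b_0(t)\\-g_0(t)\end{pmatrix},z(t)\Big\rangle\Big]dt.$$ -/

import Mathlib

open MeasureTheory Set Filter Topology
open scoped InnerProductSpace

noncomputable section

/-- A `C₀`-semigroup `t ↦ e^{At}` (`t ≥ 0`) of bounded operators on `X`. The values at negative
times are irrelevant and carry no condition. -/
structure C0Semigroup (X : Type*) [NormedAddCommGroup X] [InnerProductSpace ℝ X] where
  /-- the operator `e^{At}` -/
  op : ℝ → X →L[ℝ] X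
  op_zero : op 0 = ContinuousLinearMap.id ℝ X
  op_add : ∀ s t : ℝ, 0 ≤ s → 0 ≤ t → op (s + t) = (op s).comp (op t)
  tendsto_zero : ∀ x : X, Tendsto (fun t => op t x) (𝓝[>] 0) (𝓝 x)

/-- `A : 𝒟(A) ⊆ X → X` is the infinitesimal generator of the semigroup `S`: `x ∈ 𝒟(A)` with
`A x = z` exactly when `(S(t)x - x)/t → z` as `t ↓ 0`. -/
def C0Semigroup.IsGenerator {X : Type*} [NormedAddCommGroup X] [InnerProductSpace ℝ X]
    (S : C0Semigroup X) (A : X →ₗ.[ℝ] X) : Prop :=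
  ∀ x z : X, (x, z) ∈ A.graph ↔
    Tendsto (fun t : ℝ => t⁻¹ • (S.op t x - x)) (𝓝[>] 0) (𝓝 z)

/-- `B(·) ∈ L^∞(0,T;ℒ(X))`: strongly measurable (each `t ↦ B(t)x` is measurable) and
essentially bounded in operator norm. -/
structure IsLinftyOp {X : Type*} [NormedAddCommGroup X] [InnerProductSpace ℝ X]
    (T : ℝ) (B : ℝ → X →L[ℝ] X) : Prop where
  meas : ∀ x : X, AEStronglyMeasurable (fun t => B t x) (volume.restrict (Icc 0 T))
  bdd : ∃ K : ℝ, ∀ᵐ t ∂(volume.restrict (Icc 0 T)), ‖B t‖ ≤ K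

/-- `F : [0,T] → ℒ(X)` is strongly continuous. -/
def IsStronglyContinuousOp {X : Type*} [NormedAddCommGroup X] [InnerProductSpace ℝ X]
    (T : ℝ) (F : ℝ → X →L[ℝ] X) : Prop :=
  ∀ x : X, ContinuousOn (fun t => F t x) (Icc 0 T)

/-- The operator `[[a, b], [c, d]]` on the Hilbert space `X × X`. -/
def blockOp {X : Type*} [NormedAddCommGroup X] [InnerProductSpace ℝ X]
    (a b c d : X →L[ℝ] X) : WithLp 2 (X × X) →L[ℝ] WithLp 2 (X × X) :=
  ((WithLp.prodContinuousLinearEquiv 2 ℝ X X).symm : X × X →L[ℝ] WithLp 2 (X × X)).comp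
    (((a.coprod b).prod (c.coprod d)).comp
      (WithLp.prodContinuousLinearEquiv 2 ℝ X X : WithLp 2 (X × X) →L[ℝ] X × X))

/-- Mild solution `(y, ψ)` of the linear forward-backward evolution equation
`y' = A y + B₁₁ y + B₁₂ ψ + b₀`, `ψ' = -A^* ψ - B₂₁ y - B₂₂ ψ - g₀` on `[0,T]` with `y(0)` and
`ψ(T)` given, where `A` generates `S` and `e^{A^* t} = (e^{At})^*`. -/
structure IsMildSolutionFBEE {X : Type*} [NormedAddCommGroup X] [InnerProductSpace ℝ X]
    [CompleteSpace X] (S : C0Semigroup X) (T : ℝ) (B₁₁ B₁₂ B₂₁ B₂₂ : ℝ → X →L[ℝ] X)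
    (b₀ g₀ : ℝ → X) (y ψ : ℝ → X) : Prop where
  cont_y : ContinuousOn y (Icc 0 T)
  cont_ψ : ContinuousOn ψ (Icc 0 T)
  forward : ∀ t ∈ Icc 0 T,
    y t = S.op t (y 0)
      + ∫ s in (0 : ℝ)..t, S.op (t - s) (B₁₁ s (y s) + B₁₂ s (ψ s) + b₀ s)
  backward : ∀ t ∈ Icc 0 T,
    ψ t = (S.op (T - t)).adjoint (ψ T)
      + ∫ s in t..T, (S.op (s - t)).adjoint (B₂₁ s (y s) + B₂₂ s (ψ s) + g₀ s)

/-- Mild solution of `P' + P (A - M) + (A - M)^* P + Q₀ = 0` on `[0,T]`, with values in the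
self-adjoint operators. Integrals of operators are taken in the strong sense. -/
structure IsMildSolutionP {X : Type*} [NormedAddCommGroup X] [InnerProductSpace ℝ X]
    [CompleteSpace X] (S : C0Semigroup X) (T : ℝ) (M Q₀ P : ℝ → X →L[ℝ] X) : Prop where
  cont : IsStronglyContinuousOp T P
  selfAdjoint : ∀ t ∈ Icc 0 T, IsSelfAdjoint (P t)
  eq : ∀ t ∈ Icc 0 T, ∀ x : X,
    P t x = (S.op (T - t)).adjoint (P T (S.op (T - t) x))
      - ∫ s in t..T, (S.op (s - t)).adjoint
          ((P s * M s + (M s).adjoint * P s - Q₀ s) (S.op (s - t) x))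

/-- Mild solution of `R' - R (A - N)^* - (A - N) R + R₀ = 0` on `[0,T]`, with values in the
self-adjoint operators (in the Lyapunov equation, `R` is the lower right block). -/
structure IsMildSolutionPbar {X : Type*} [NormedAddCommGroup X] [InnerProductSpace ℝ X]
    [CompleteSpace X] (S : C0Semigroup X) (T : ℝ) (N R₀ R : ℝ → X →L[ℝ] X) : Prop where
  cont : IsStronglyContinuousOp T R
  selfAdjoint : ∀ t ∈ Icc 0 T, IsSelfAdjoint (R t)
  eq : ∀ t ∈ Icc 0 T, ∀ x : X,
    R t x = S.op t (R 0 ((S.op t).adjoint x))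
      - ∫ s in (0 : ℝ)..t, S.op (t - s)
          ((R s * (N s).adjoint + N s * R s + R₀ s) ((S.op (t - s)).adjoint x))

/-- Mild solution of `Γ' + Γ (A - M) - (A - N) Γ + Θ = 0` when `A^* = A`: each `Γ(t)` maps
`𝒟(A)` into itself and commutes with `A` there, and `Γ' - Γ M + N Γ + Θ = 0` holds in
integrated form. -/
structure IsMildSolutionGammaSelfAdjoint {X : Type*} [NormedAddCommGroup X]
    [InnerProductSpace ℝ X] (A : X →ₗ.[ℝ] X) (T : ℝ) (M N Θ Γ : ℝ → X →L[ℝ] X) : Prop where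
  cont : IsStronglyContinuousOp T Γ
  comm : ∀ t ∈ Icc 0 T, ∀ x : A.domain,
    ∃ h : Γ t (x : X) ∈ A.domain, A ⟨Γ t (x : X), h⟩ = Γ t (A x)
  eq : ∀ t ∈ Icc 0 T, ∀ x : X,
    Γ t x = Γ T x + ∫ s in t..T, (N s * Γ s - Γ s * M s + Θ s) x

/-- Mild solution of `Γ' + Γ (A - M) - (A - N) Γ + Θ = 0` when `A^* = -A`. In this case `e^{At}`
is invertible, and `e^{-At}` is its inverse. -/
structure IsMildSolutionGammaSkewAdjoint {X : Type*} [NormedAddCommGroup X]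
    [InnerProductSpace ℝ X] (S : C0Semigroup X) (T : ℝ) (M N Θ Γ : ℝ → X →L[ℝ] X) : Prop where
  cont : IsStronglyContinuousOp T Γ
  eq : ∀ t ∈ Icc 0 T, ∀ x : X,
    Γ t x = Ring.inverse (S.op (T - t)) (Γ T (S.op (T - t) x))
      + ∫ s in t..T, Ring.inverse (S.op (s - t))
          ((N s * Γ s - Γ s * M s + Θ s) (S.op (s - t) x))

/-- `Π = [[P, Γ^*], [Γ, R]]` is a mild solution of the Lyapunov differential equation
`Π' + Π (𝔸 - 𝕄) + (𝔸 - 𝕄)^* Π + ℚ = 0` with `𝔸 = diag(A, -A^*)`, `𝕄 = diag(M, -N^*)` and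
`ℚ = [[Q₀, Θ^*], [Θ, R₀]]`, where `A^* = A` or `A^* = -A` generates `S`. -/
structure IsMildSolutionLyapunov {X : Type*} [NormedAddCommGroup X] [InnerProductSpace ℝ X]
    [CompleteSpace X] (A : X →ₗ.[ℝ] X) (S : C0Semigroup X) (T : ℝ)
    (M N Q₀ R₀ Θ P R Γ : ℝ → X →L[ℝ] X) : Prop where
  upper : IsMildSolutionP S T M Q₀ P
  lower : IsMildSolutionPbar S T N R₀ R
  offdiag_selfAdjoint : A.adjoint = A → IsMildSolutionGammaSelfAdjoint A T M N Θ Γ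
  offdiag_skewAdjoint : A.adjoint = -A → IsMildSolutionGammaSkewAdjoint S T M N Θ Γ

end

/-! Expand `⟨Πz, z⟩ = ⟨P y, y⟩ + 2⟨Γ y, ψ⟩ + ⟨R ψ, ψ⟩`, where `R`, `N`, `R₀` stand for the barred
`P`, `M`, `Q₀`. Formally one differentiates each term and the unbounded operator `A` cancels. Mild
solutions need not be differentiable, so the product rule is replaced by exact increments and a
Riemann-sum argument; `A` is never regularised.

For `t ≤ t'` a mild solution satisfies `u(t') = S(t'-t) u(t) + r` with `r = ∫ S(t'-s) φ(s) ds`, and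
the mild equation for `G` expresses `⟨G(t)x, w⟩` through `G(t')` evaluated at `S(t'-t)x`,
`S(t'-t)w`. Substituting `S(t'-t)u(t) = u(t') - r` writes the increment of `⟨G u, u⟩` exactly as an
integral over `[t,t']` whose integrand depends on `(t,s,t')` only through strongly continuous
kernels. Replacing `(t,s,t')` by `(s,s,s)` gives the desired integrand. The error is `IsNegligible`:
on short intervals it is at most `∫ m` over `[t,t']`, where `∫ m` over `[0,T]` is arbitrarily small.
Telescoping over a uniform partition (`IsNegligible.sub_eq_integral`) yields the identity on
`[0,T]`.

This gives `quadratic_eq_integral` for `P`; reversing time and exchanging `S` with its adjoint gives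
`quadratic_backward_eq_integral` for `R`. The mixed term (`bilinear_eq_integral`) is where `A^* =
±A` enters the equations: if `A^* = A`, `Γ` commutes with the semigroup; if `A^* = -A`, the
semigroup is unitary, its inverse is its adjoint, and the equation for `Γ` takes the same form as
that for `P`. The sum of the three identities is the theorem, by pointwise algebra. -/

/-! ### Strongly continuous operator families and right derivatives. -/

section StrongContinuity

variable {α E F : Type*} [TopologicalSpace α] [NormedAddCommGroup E] [NormedSpace ℝ E]
  [NormedAddCommGroup F] [NormedSpace ℝ F]

/-- A bounded strongly continuous family of operators maps continuous functions to continuous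
functions. -/
theorem continuousOn_clm_apply_of_bounded {D : Set α} {L : α → E →L[ℝ] F} {w : α → E} {C : ℝ}
    (hC : ∀ p ∈ D, ‖L p‖ ≤ C) (hL : ∀ x, ContinuousOn (fun p => L p x) D)
    (hw : ContinuousOn w D) : ContinuousOn (fun p => L p (w p)) D := by
  intro p hp
  have h1 : Tendsto (fun q => L q (w q - w p)) (𝓝[D] p) (𝓝 0) := by
    have h2 : Tendsto (fun q => C * ‖w q - w p‖) (𝓝[D] p) (𝓝 0) := by
      have := ((hw p hp).sub (continuousWithinAt_const (b := w p))).norm.const_mul C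
      simpa [ContinuousWithinAt] using this
    refine squeeze_zero_norm' ?_ h2
    filter_upwards [self_mem_nhdsWithin] with q hq
    exact (L q).le_of_opNorm_le (hC q hq) _
  have h3 := h1.add (hL (w p) p hp)
  simpa [ContinuousWithinAt] using h3

/-- A strongly continuous family of operators on a compact set is bounded. -/
theorem exists_norm_le_of_isCompact [CompleteSpace E] {D : Set α} (hD : IsCompact D)
    {L : α → E →L[ℝ] F} (hL : ∀ x, ContinuousOn (fun p => L p x) D) :
    ∃ C, 0 ≤ C ∧ ∀ p ∈ D, ‖L p‖ ≤ C := by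
  obtain ⟨C, hC⟩ := banach_steinhaus (g := fun p : D => L p) (fun x => by
    obtain ⟨C, hC⟩ := hD.exists_bound_of_continuousOn (hL x)
    exact ⟨C, fun p => hC p p.2⟩)
  exact ⟨max C 0, le_max_right _ _, fun p hp => (hC ⟨p, hp⟩).trans (le_max_left _ _)⟩

end StrongContinuity

/-- Generators give only one-sided difference quotients. A right derivative is enough, since
`constant_of_has_deriv_right_zero` asks only for continuity and a vanishing right derivative. -/
theorem hasDerivWithinAt_Ici_of_tendsto {E : Type*} [NormedAddCommGroup E] [NormedSpace ℝ E]
    {f : ℝ → E} {f' : E} {x : ℝ}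
    (h : Tendsto (fun t : ℝ => t⁻¹ • (f (x + t) - f x)) (𝓝[>] 0) (𝓝 f')) :
    HasDerivWithinAt f f' (Ici x) x := by
  rw [hasDerivWithinAt_iff_tendsto_slope, Ici_sdiff_left]
  have h1 : Tendsto (fun y : ℝ => y - x) (𝓝[>] x) (𝓝[>] 0) := by
    refine tendsto_nhdsWithin_iff.2 ⟨?_, ?_⟩
    · have : Tendsto (fun y : ℝ => y - x) (𝓝 x) (𝓝 (x - x)) :=
        (continuous_id.sub continuous_const).tendsto x
      rw [sub_self] at this
      exact this.mono_left nhdsWithin_le_nhds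
    · filter_upwards [self_mem_nhdsWithin] with y hy
      exact mem_Ioi.2 (sub_pos.2 (mem_Ioi.1 hy))
  refine (h.comp h1).congr fun y => ?_
  simp [slope_def_module]

/-! ### C₀-semigroups: local bounds, continuity, density of the domain, commutation. -/

namespace C0Semigroup

variable {X : Type*} [NormedAddCommGroup X] [InnerProductSpace ℝ X]

/-- The graph of the generator. -/
def Gen (S : C0Semigroup X) (x z : X) : Prop :=
  Tendsto (fun t : ℝ => t⁻¹ • (S.op t x - x)) (𝓝[>] 0) (𝓝 z)

theorem op_add_apply (S : C0Semigroup X) {s t : ℝ} (hs : 0 ≤ s) (ht : 0 ≤ t) (x : X) :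
    S.op (s + t) x = S.op s (S.op t x) := by
  rw [S.op_add s t hs ht]; rfl

theorem tendsto_zero_Ici (S : C0Semigroup X) (x : X) :
    Tendsto (fun t => S.op t x) (𝓝[≥] 0) (𝓝 x) := by
  rw [← Ioi_insert, nhdsWithin_insert, tendsto_sup]
  refine ⟨?_, S.tendsto_zero x⟩
  rw [tendsto_pure_left]
  intro s hs
  simpa [S.op_zero] using mem_of_mem_nhds hs

/-- Uniform boundedness near `0`, propagated to `[0, b]` by the semigroup law. -/
theorem exists_bound [CompleteSpace X] (S : C0Semigroup X) (b : ℝ) :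
    ∃ C, 1 ≤ C ∧ ∀ t ∈ Icc 0 b, ‖S.op t‖ ≤ C := by
  have h1 : ∃ δ > 0, ∃ C : ℝ, ∀ t ∈ Icc 0 δ, ‖S.op t‖ ≤ C := by
    by_contra! hcon
    -- Failure near `0` gives `tₙ → 0` with `‖S(tₙ)‖ > n`, although every orbit `S(tₙ)x` converges
    -- and so is bounded: this contradicts Banach–Steinhaus.
    choose t ht hbig using fun n : ℕ => hcon (1 / ((n : ℝ) + 1)) (by positivity) n
    have htl : Tendsto t atTop (𝓝[≥] 0) := by
      refine tendsto_nhdsWithin_iff.2 ⟨?_, Eventually.of_forall fun n => (ht n).1⟩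
      exact squeeze_zero (fun n => (ht n).1) (fun n => (ht n).2)
        tendsto_one_div_add_atTop_nhds_zero_nat
    obtain ⟨C, hC⟩ := banach_steinhaus (g := fun n => S.op (t n)) (fun x => by
      obtain ⟨C, hC⟩ := (((S.tendsto_zero_Ici x).comp htl).norm).bddAbove_range
      exact ⟨C, fun n => hC ⟨n, rfl⟩⟩)
    obtain ⟨n, hn⟩ := exists_nat_gt C
    exact absurd (hC n) (not_le.2 (hn.trans (hbig n)))
  obtain ⟨δ, hδ, C, hC⟩ := h1
  set C' := max C 1
  have hC'1 : 1 ≤ C' := le_max_right _ _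
  have h2 : ∀ n : ℕ, ∀ t ∈ Icc 0 (n * δ), ‖S.op t‖ ≤ C' ^ (n + 1) := by
    intro n
    induction n with
    | zero =>
      intro t ht
      have : t = 0 := by simpa using ht
      rw [zero_add, pow_one]
      exact (hC t ⟨ht.1, by rw [this]; exact hδ.le⟩).trans (le_max_left C 1)
    | succ n ih =>
      intro t ht
      rcases le_total t δ with h | h
      · calc ‖S.op t‖ ≤ C' := (hC t ⟨ht.1, h⟩).trans (le_max_left _ _)
          _ ≤ C' ^ (n + 1 + 1) := le_self_pow₀ hC'1 (by omega)
      · have h3 := ih (t - δ) ⟨by linarith, by have := ht.2; push_cast at this; linarith⟩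
        have h4 : S.op t = (S.op (t - δ)).comp (S.op δ) := by
          rw [← S.op_add _ _ (by linarith) hδ.le]; congr 1; ring
        rw [h4, pow_succ]
        refine (ContinuousLinearMap.opNorm_comp_le _ _).trans ?_
        exact mul_le_mul h3 ((hC δ ⟨hδ.le, le_rfl⟩).trans (le_max_left _ _)) (norm_nonneg _)
          (by positivity)
  obtain ⟨n, hn⟩ := exists_nat_gt (b / δ)
  rw [div_lt_iff₀ hδ] at hn
  exact ⟨C' ^ (n + 1), one_le_pow₀ hC'1, fun t ht => h2 n t ⟨ht.1, ht.2.trans hn.le⟩⟩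

/-- Factoring out the operator at the smaller time, `S(s)x - S(t)x = S(t)(S(s-t)x - x)`, reduces
two-sided continuity at any time to the limit at `0`. -/
theorem norm_op_sub_op_le (S : C0Semigroup X) {b C : ℝ} (hC : ∀ t ∈ Icc 0 b, ‖S.op t‖ ≤ C)
    {s t : ℝ} (hs : s ∈ Icc 0 b) (ht : t ∈ Icc 0 b) (x : X) :
    ‖S.op s x - S.op t x‖ ≤ C * ‖S.op |s - t| x - x‖ := by
  have key : ∀ s ∈ Icc 0 b, ∀ t ∈ Icc 0 b, t ≤ s →
      ‖S.op s x - S.op t x‖ ≤ C * ‖S.op |s - t| x - x‖ := by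
    intro s hs t ht h
    rw [abs_of_nonneg (sub_nonneg.2 h)]
    have : S.op s x - S.op t x = S.op t (S.op (s - t) x - x) := by
      rw [map_sub, ← S.op_add_apply ht.1 (sub_nonneg.2 h)]; congr 3; ring
    rw [this]
    exact (S.op t).le_of_opNorm_le (hC t ht) _
  rcases le_total t s with h | h
  · exact key s hs t ht h
  · rw [norm_sub_rev, abs_sub_comm]; exact key t ht s hs h

theorem continuousOn_op [CompleteSpace X] (S : C0Semigroup X) (b : ℝ) (x : X) :
    ContinuousOn (fun t => S.op t x) (Icc 0 b) := by
  obtain ⟨C, -, hC⟩ := S.exists_bound b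
  intro t ht
  have h1 : Tendsto (fun s : ℝ => |s - t|) (𝓝[Icc 0 b] t) (𝓝[≥] 0) := by
    refine tendsto_nhdsWithin_iff.2 ⟨?_, Eventually.of_forall fun s => mem_Ici.2 (abs_nonneg _)⟩
    have : Tendsto (fun s : ℝ => |s - t|) (𝓝 t) (𝓝 |t - t|) :=
      (continuous_id.sub continuous_const).abs.tendsto t
    rw [sub_self, abs_zero] at this
    exact this.mono_left nhdsWithin_le_nhds
  have h2 : Tendsto (fun s : ℝ => C * ‖S.op |s - t| x - x‖) (𝓝[Icc 0 b] t) (𝓝 0) := by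
    simpa using ((((S.tendsto_zero_Ici x).comp h1).sub_const x).norm.const_mul C)
  rw [ContinuousWithinAt, tendsto_iff_norm_sub_tendsto_zero]
  refine squeeze_zero' (Eventually.of_forall fun s => norm_nonneg _) ?_ h2
  filter_upwards [self_mem_nhdsWithin] with s hs
  exact S.norm_op_sub_op_le hC hs ht x

theorem continuousOn_op_apply [CompleteSpace X] (S : C0Semigroup X) {α : Type*}
    [TopologicalSpace α] {D : Set α} {τ : α → ℝ} {w : α → X} (b : ℝ) (hτ : ContinuousOn τ D)
    (hτD : ∀ p ∈ D, τ p ∈ Icc 0 b) (hw : ContinuousOn w D) :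
    ContinuousOn (fun p => S.op (τ p) (w p)) D := by
  obtain ⟨C, -, hC⟩ := S.exists_bound b
  exact continuousOn_clm_apply_of_bounded (fun p hp => hC _ (hτD p hp))
    (fun x => (S.continuousOn_op b x).comp hτ hτD) hw

theorem Gen.op {S : C0Semigroup X} {x z : X} (h : S.Gen x z) {t : ℝ} (ht : 0 ≤ t) :
    S.Gen (S.op t x) (S.op t z) := by
  refine (((S.op t).continuous.tendsto z).comp h).congr' ?_
  filter_upwards [self_mem_nhdsWithin] with s hs
  have hs' : (0 : ℝ) ≤ s := le_of_lt hs
  simp only [Function.comp, map_smul, map_sub]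
  rw [← S.op_add_apply ht hs', add_comm, S.op_add_apply hs' ht]

theorem Gen.hasDerivWithinAt {S : C0Semigroup X} {x z : X} (h : S.Gen x z) {t : ℝ} (ht : 0 ≤ t) :
    HasDerivWithinAt (fun s => S.op s x) (S.op t z) (Ici t) t := by
  apply hasDerivWithinAt_Ici_of_tendsto
  refine (h.op ht).congr' ?_
  filter_upwards [self_mem_nhdsWithin] with s hs
  rw [add_comm, S.op_add_apply (le_of_lt hs) ht]

/-- The means `∫₀ʰ S(s)x ds` belong to the domain of the generator. -/
theorem gen_integral [CompleteSpace X] (S : C0Semigroup X) (x : X) {h : ℝ} (hh : 0 < h) :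
    S.Gen (∫ s in (0 : ℝ)..h, S.op s x) (S.op h x - x) := by
  have hc := S.continuousOn_op (h + 1) x
  have hint : ∀ a b : ℝ, a ∈ Icc 0 (h + 1) → b ∈ Icc 0 (h + 1) →
      IntervalIntegrable (fun s => S.op s x) volume a b := fun a b ha hb =>
    (hc.mono (uIcc_subset_Icc ha hb)).intervalIntegrable
  have hder : ∀ a ∈ Ico 0 (h + 1), Tendsto
      (fun k : ℝ => k⁻¹ • ((∫ s in (0 : ℝ)..(a + k), S.op s x) - ∫ s in (0 : ℝ)..a, S.op s x))
      (𝓝[>] 0) (𝓝 (S.op a x)) := by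
    intro a ha
    have h0 : ContinuousWithinAt (fun s => S.op s x) (Ioi a) a :=
      ((hc a ⟨ha.1, ha.2.le⟩).mono_of_mem_nhdsWithin (by
        filter_upwards [Ioo_mem_nhdsGT ha.2] with y hy
        exact ⟨ha.1.trans hy.1.le, hy.2.le⟩))
    have h1 : HasDerivWithinAt (fun u => ∫ s in (0 : ℝ)..u, S.op s x) (S.op a x) (Ici a) a := by
      refine intervalIntegral.integral_hasDerivWithinAt_right
        (hint 0 a ⟨le_rfl, by linarith⟩ ⟨ha.1, ha.2.le⟩) ?_ h0
      refine ⟨Ioo a (h + 1), Ioo_mem_nhdsGT ha.2, ?_⟩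
      exact (hc.mono fun y hy => ⟨ha.1.trans hy.1.le, hy.2.le⟩).aestronglyMeasurable
        measurableSet_Ioo
    rw [hasDerivWithinAt_iff_tendsto_slope, Ici_sdiff_left] at h1
    have h2 : Tendsto (fun k : ℝ => a + k) (𝓝[>] 0) (𝓝[>] a) := by
      refine tendsto_nhdsWithin_iff.2 ⟨?_, ?_⟩
      · have : Tendsto (fun k : ℝ => a + k) (𝓝 0) (𝓝 (a + 0)) :=
          (continuous_const.add continuous_id).tendsto 0
        rw [add_zero] at this
        exact this.mono_left nhdsWithin_le_nhds
      · filter_upwards [self_mem_nhdsWithin] with y hy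
        exact lt_add_of_pos_right a hy
    refine (h1.comp h2).congr fun k => ?_
    simp [slope_def_module]
  have h3 := (hder h ⟨hh.le, by linarith⟩).sub (hder 0 ⟨le_rfl, by linarith⟩)
  rw [S.op_zero] at h3
  refine h3.congr' ?_
  filter_upwards [Ioo_mem_nhdsGT (zero_lt_one' ℝ)] with k hk
  rw [← smul_sub]
  congr 1
  -- `S(k)` shifts the window of integration to `[k, h+k]`; the overlap with `[0, h]` cancels,
  -- leaving one short integral at each end.
  have h4 : S.op k (∫ s in (0 : ℝ)..h, S.op s x) = ∫ s in k..(h + k), S.op s x := by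
    rw [← ContinuousLinearMap.intervalIntegral_comp_comm _
      (hint 0 h ⟨le_rfl, by linarith⟩ ⟨hh.le, by linarith⟩)]
    have := intervalIntegral.integral_comp_add_right (a := 0) (b := h) (fun s => S.op s x) k
    rw [zero_add] at this
    rw [← this]
    refine intervalIntegral.integral_congr fun s hs => ?_
    rw [uIcc_of_le hh.le] at hs
    rw [add_comm s k, S.op_add_apply hk.1.le hs.1]
  have hk' : k ∈ Icc 0 (h + 1) := ⟨hk.1.le, by linarith [hk.2]⟩
  have h0' : (0 : ℝ) ∈ Icc 0 (h + 1) := ⟨le_rfl, by linarith⟩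
  have hhk : h + k ∈ Icc 0 (h + 1) := ⟨by linarith [hk.1], by linarith [hk.2]⟩
  have h5 := intervalIntegral.integral_add_adjacent_intervals (hint 0 k h0' hk') (hint k _ hk' hhk)
  rw [h4, ← h5]
  simp only [intervalIntegral.integral_same, zero_add]
  abel

/-- The domain of the generator is dense. -/
theorem exists_gen_tendsto [CompleteSpace X] (S : C0Semigroup X) (x : X) :
    ∃ u : ℕ → X, (∀ n, ∃ z, S.Gen (u n) z) ∧ Tendsto u atTop (𝓝 x) := by
  have hc := S.continuousOn_op 1 x
  have h0 : ContinuousWithinAt (fun s => S.op s x) (Ioi 0) 0 :=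
    ((hc 0 ⟨le_rfl, zero_le_one⟩).mono_of_mem_nhdsWithin (by
      filter_upwards [Ioo_mem_nhdsGT (zero_lt_one' ℝ)] with y hy
      exact ⟨hy.1.le, hy.2.le⟩))
  have h1 : HasDerivWithinAt (fun u => ∫ s in (0 : ℝ)..u, S.op s x) (S.op 0 x) (Ici 0) 0 := by
    refine intervalIntegral.integral_hasDerivWithinAt_right (by simp) ?_ h0
    refine ⟨Ioo 0 1, Ioo_mem_nhdsGT one_pos, ?_⟩
    exact (hc.mono fun y hy => ⟨hy.1.le, hy.2.le⟩).aestronglyMeasurable measurableSet_Ioo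
  rw [hasDerivWithinAt_iff_tendsto_slope, Ici_sdiff_left, S.op_zero] at h1
  have h2 : Tendsto (fun n : ℕ => 1 / ((n : ℝ) + 1)) atTop (𝓝[>] 0) :=
    tendsto_nhdsWithin_iff.2 ⟨tendsto_one_div_add_atTop_nhds_zero_nat,
      Eventually.of_forall fun n => by simp only [mem_Ioi]; positivity⟩
  refine ⟨_, fun n => ?_, h1.comp h2⟩
  have hn : (0 : ℝ) < 1 / ((n : ℝ) + 1) := by positivity
  have h3 := (S.gen_integral x hn).const_smul (1 / ((n : ℝ) + 1) - 0)⁻¹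
  refine ⟨_, h3.congr fun t => ?_⟩
  simp only [Function.comp, slope_def_module, intervalIntegral.integral_same, sub_zero]
  rw [smul_comm, map_smul, smul_sub ((1 / ((n : ℝ) + 1))⁻¹)]

theorem eq_of_eqOn_gen [CompleteSpace X] (S : C0Semigroup X) {Y : Type*} [TopologicalSpace Y]
    [T2Space Y] {f g : X → Y} (hf : Continuous f) (hg : Continuous g)
    (h : ∀ x z, S.Gen x z → f x = g x) (x : X) : f x = g x := by
  obtain ⟨u, hu, hux⟩ := S.exists_gen_tendsto x
  refine tendsto_nhds_unique ((hf.tendsto x).comp hux) (((hg.tendsto x).comp hux).congr fun n => ?_)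
  obtain ⟨z, hz⟩ := hu n
  exact (h _ _ hz).symm

theorem dense_domain [CompleteSpace X] {S : C0Semigroup X} {A : X →ₗ.[ℝ] X}
    (hS : S.IsGenerator A) : Dense (A.domain : Set X) := by
  intro x
  obtain ⟨u, hu, hux⟩ := S.exists_gen_tendsto x
  refine mem_closure_of_tendsto hux (Eventually.of_forall fun n => ?_)
  obtain ⟨z, hz⟩ := hu n
  exact LinearPMap.mem_domain_of_mem_graph ((hS _ _).2 hz)

/-- An operator commuting with the generator commutes with the semigroup. -/
theorem op_comm_of_gen_comm [CompleteSpace X] (S : C0Semigroup X) {G : X →L[ℝ] X}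
    (hG : ∀ x z, S.Gen x z → S.Gen (G x) (G z)) {t : ℝ} (ht : 0 ≤ t) (x : X) :
    G (S.op t x) = S.op t (G x) := by
  refine S.eq_of_eqOn_gen (G.continuous.comp (S.op t).continuous)
    ((S.op t).continuous.comp G.continuous) (fun x z hxz => ?_) x
  obtain ⟨C, -, hC⟩ := S.exists_bound t
  have hcont : ContinuousOn (fun s => S.op (t - s) (G (S.op s x))) (Icc 0 t) :=
    S.continuousOn_op_apply t (by fun_prop) (fun s hs => ⟨by linarith [hs.2], by linarith [hs.1]⟩)
      (G.continuous.comp_continuousOn (S.continuousOn_op t x))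
  -- The path `s ↦ S(t-s) G S(s) x` joins `S(t)Gx` to `GS(t)x`; its right derivative is `S(t-s)`
  -- applied to the commutator of `G` and the generator, which is zero.
  have hder : ∀ s ∈ Ico 0 t,
      HasDerivWithinAt (fun s => S.op (t - s) (G (S.op s x))) 0 (Ici s) s := by
    intro s hs
    apply hasDerivWithinAt_Ici_of_tendsto
    have hg := hxz.op hs.1
    have h1 := ((G.continuous.tendsto _).comp hg).sub (hG _ _ hg)
    rw [sub_self] at h1
    have h2 := h1.norm.const_mul C
    rw [norm_zero, mul_zero] at h2
    refine squeeze_zero_norm' ?_ h2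
    filter_upwards [Ioo_mem_nhdsGT (sub_pos.2 hs.2)] with k hk
    have e1 : S.op (t - s) (G (S.op s x)) = S.op (t - (s + k)) (S.op k (G (S.op s x))) := by
      rw [← S.op_add_apply (by linarith [hk.2]) hk.1.le]; congr 2; ring
    have e2 : S.op (s + k) x = S.op k (S.op s x) := by
      rw [add_comm, S.op_add_apply hk.1.le hs.1]
    have e3 : k⁻¹ • (S.op (t - (s + k)) (G (S.op (s + k) x)) - S.op (t - s) (G (S.op s x)))
        = S.op (t - (s + k)) (G (k⁻¹ • (S.op k (S.op s x) - S.op s x))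
          - k⁻¹ • (S.op k (G (S.op s x)) - G (S.op s x))) := by
      rw [e1, e2]
      simp only [map_smul, map_sub, smul_sub]
      abel
    rw [e3]
    exact (S.op _).le_of_opNorm_le (hC _ ⟨by linarith [hk.2], by linarith [hs.1, hk.1]⟩) _
  have := constant_of_has_deriv_right_zero hcont hder t ⟨ht, le_rfl⟩
  simpa [S.op_zero] using this

/-! ### The adjoint semigroup when the generator is self-adjoint or skew-adjoint. -/

/-- The generator `A` satisfies `A^* = ε A`. -/
def HasScaledAdjoint (S : C0Semigroup X) (ε : ℝ) : Prop :=
  ∀ x u : X, S.Gen x (ε • u) ↔ ∀ a b, S.Gen a b → ⟪b, x⟫_ℝ = ⟪a, u⟫_ℝ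

theorem hasScaledAdjoint_one [CompleteSpace X] {S : C0Semigroup X} {A : X →ₗ.[ℝ] X}
    (hS : S.IsGenerator A) (hA : A.adjoint = A) : S.HasScaledAdjoint 1 := by
  intro x u
  rw [one_smul, Gen, ← hS, ← hA, LinearPMap.adjoint_graph_eq_graph_adjoint (dense_domain hS),
    Submodule.mem_adjoint_iff]
  simp only [sub_eq_zero]
  exact forall₂_congr fun a b => by rw [hS]; rfl

theorem hasScaledAdjoint_neg_one [CompleteSpace X] {S : C0Semigroup X} {A : X →ₗ.[ℝ] X}
    (hS : S.IsGenerator A) (hA : A.adjoint = -A) : S.HasScaledAdjoint (-1) := by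
  intro x u
  have h1 : (x, -u) ∈ A.graph ↔ (x, u) ∈ (-A).graph := by
    rw [LinearPMap.neg_graph]
    simp only [Submodule.mem_map, LinearMap.prodMap_apply, LinearMap.id_apply, LinearMap.neg_apply,
      Prod.mk.injEq, Prod.exists]
    constructor
    · intro h; exact ⟨x, -u, h, rfl, by simp⟩
    · rintro ⟨a, b, h, rfl, rfl⟩; simpa using h
  rw [neg_smul, one_smul, Gen, ← hS, h1, ← hA,
    LinearPMap.adjoint_graph_eq_graph_adjoint (dense_domain hS), Submodule.mem_adjoint_iff]
  simp only [sub_eq_zero]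
  exact forall₂_congr fun a b => by rw [hS]; rfl

variable [CompleteSpace X] {S : C0Semigroup X}

/-- Pairing with the domain moves `S(t)^*` onto the other factor, where `S(t)` preserves the
generator's graph. Hence `S(t)^*` respects the graph of `A^*`, which is that of `A` up to sign. -/
theorem Gen.adjoint_op {ε : ℝ} (hε : ε * ε = 1) (hS : S.HasScaledAdjoint ε) {x z : X}
    (h : S.Gen x z) {t : ℝ} (ht : 0 ≤ t) :
    S.Gen ((S.op t).adjoint x) ((S.op t).adjoint z) := by
  have h1 : S.Gen x (ε • (ε • z)) := by rwa [smul_smul, hε, one_smul]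
  have h2 := (hS x (ε • z)).1 h1
  have h3 := (hS ((S.op t).adjoint x) (ε • (S.op t).adjoint z)).2 fun a b hab => by
    rw [← map_smul, ContinuousLinearMap.adjoint_inner_right,
      ContinuousLinearMap.adjoint_inner_right]
    exact h2 _ _ (hab.op ht)
  rwa [smul_smul, hε, one_smul] at h3

/-- For `x`, `w` in the domain, symmetry of `A` makes `s ↦ ⟨S(t-s)x, S(s)w⟩` constant; compare `s =
0` and `s = t`, and extend by density in each variable. -/
theorem adjoint_op_eq (hS : S.HasScaledAdjoint 1) {t : ℝ} (ht : 0 ≤ t) :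
    (S.op t).adjoint = S.op t := by
  symm
  rw [ContinuousLinearMap.eq_adjoint_iff]
  intro x w
  refine S.eq_of_eqOn_gen (f := fun x => ⟪S.op t x, w⟫_ℝ) (g := fun x => ⟪x, S.op t w⟫_ℝ)
    (by fun_prop) (by fun_prop) (fun x z hxz => ?_) x
  refine S.eq_of_eqOn_gen (f := fun w => ⟪S.op t x, w⟫_ℝ) (g := fun w => ⟪x, S.op t w⟫_ℝ)
    (by fun_prop) (by fun_prop) (fun w v hwv => ?_) w
  have hcx : ContinuousOn (fun s => S.op (t - s) x) (Icc 0 t) :=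
    (S.continuousOn_op t x).comp (by fun_prop)
      (fun s hs => ⟨by linarith [hs.2], by linarith [hs.1]⟩)
  have hcz : ContinuousOn (fun s => S.op (t - s) z) (Icc 0 t) :=
    (S.continuousOn_op t z).comp (by fun_prop)
      (fun s hs => ⟨by linarith [hs.2], by linarith [hs.1]⟩)
  have hcont : ContinuousOn (fun s => ⟪S.op (t - s) x, S.op s w⟫_ℝ) (Icc 0 t) :=
    hcx.inner (𝕜 := ℝ) (S.continuousOn_op t w)
  obtain ⟨C, -, hC⟩ := S.exists_bound t
  have hder : ∀ s ∈ Ico 0 t,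
      HasDerivWithinAt (fun s => ⟪S.op (t - s) x, S.op s w⟫_ℝ) 0 (Ici s) s := by
    intro s hs
    apply hasDerivWithinAt_Ici_of_tendsto
    have hs' : 0 ≤ t - s := by linarith [hs.2]
    have hmap : Tendsto (fun k : ℝ => s + k) (𝓝[>] 0) (𝓝[Icc 0 t] s) := by
      refine tendsto_nhdsWithin_iff.2 ⟨?_, ?_⟩
      · have : Tendsto (fun k : ℝ => s + k) (𝓝 0) (𝓝 (s + 0)) :=
          (continuous_const.add continuous_id).tendsto 0
        rw [add_zero] at this
        exact this.mono_left nhdsWithin_le_nhds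
      · filter_upwards [Ioo_mem_nhdsGT (sub_pos.2 hs.2)] with k hk
        exact ⟨by linarith [hs.1, hk.1], by linarith [hk.2]⟩
    have hsI : s ∈ Icc 0 t := ⟨hs.1, hs.2.le⟩
    have h1 := ((hcx s hsI).tendsto.comp hmap).inner (𝕜 := ℝ) (hwv.op hs.1)
    have h2 : Tendsto (fun k : ℝ => S.op (t - (s + k)) (k⁻¹ • (S.op k x - x))) (𝓝[>] 0)
        (𝓝 (S.op (t - s) z)) := by
      have h3 : Tendsto (fun k : ℝ => S.op (t - (s + k)) (k⁻¹ • (S.op k x - x) - z)) (𝓝[>] 0)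
          (𝓝 0) := by
        have h4 := (hxz.sub_const z).norm.const_mul C
        rw [sub_self, norm_zero, mul_zero] at h4
        refine squeeze_zero_norm' ?_ h4
        filter_upwards [Ioo_mem_nhdsGT (sub_pos.2 hs.2)] with k hk
        exact (S.op _).le_of_opNorm_le (hC _ ⟨by linarith [hk.2], by linarith [hs.1, hk.1]⟩) _
      have h5 := h3.add ((hcz s hsI).tendsto.comp hmap)
      rw [zero_add] at h5
      refine h5.congr fun k => ?_
      simp only [Function.comp, map_sub, sub_add_cancel]
    have h6 := h1.sub (h2.inner (𝕜 := ℝ) (tendsto_const_nhds (x := S.op s w)))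
    have h7 : ⟪S.op (t - s) x, S.op s v⟫_ℝ - ⟪S.op (t - s) z, S.op s w⟫_ℝ = 0 := by
      rw [sub_eq_zero]
      have h8 := (hS (S.op (t - s) x) (S.op (t - s) z)).1 (by
        rw [one_smul]; exact hxz.op hs') _ _ (hwv.op hs.1)
      rw [real_inner_comm, h8, real_inner_comm]
    rw [h7] at h6
    refine h6.congr' ?_
    filter_upwards [Ioo_mem_nhdsGT (sub_pos.2 hs.2)] with k hk
    have e1 : S.op (t - s) x = S.op (t - (s + k)) (S.op k x) := by
      rw [← S.op_add_apply (by linarith [hk.2]) hk.1.le]; congr 2; ring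
    have e2 : S.op (s + k) w = S.op k (S.op s w) := by
      rw [add_comm, S.op_add_apply hk.1.le hs.1]
    simp only [Function.comp]
    rw [e1, e2]
    simp only [map_smul, map_sub, inner_sub_left, inner_sub_right, inner_smul_left,
      inner_smul_right, smul_eq_mul, RCLike.conj_to_real]
    ring
  have := constant_of_has_deriv_right_zero hcont hder t ⟨ht, le_rfl⟩
  simpa [S.op_zero] using this.symm

/-- Skew-symmetry makes the derivative of `⟨S(s)x, S(s)w⟩` vanish on the domain, so the semigroup is
isometric. -/
theorem inner_op_op (hS : S.HasScaledAdjoint (-1)) {t : ℝ} (ht : 0 ≤ t) (x w : X) :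
    ⟪S.op t x, S.op t w⟫_ℝ = ⟪x, w⟫_ℝ := by
  refine S.eq_of_eqOn_gen (f := fun x => ⟪S.op t x, S.op t w⟫_ℝ) (g := fun x => ⟪x, w⟫_ℝ)
    (by fun_prop) (by fun_prop) (fun x z hxz => ?_) x
  refine S.eq_of_eqOn_gen (f := fun w => ⟪S.op t x, S.op t w⟫_ℝ) (g := fun w => ⟪x, w⟫_ℝ)
    (by fun_prop) (by fun_prop) (fun w v hwv => ?_) w
  have hcont : ContinuousOn (fun s => ⟪S.op s x, S.op s w⟫_ℝ) (Icc 0 t) :=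
    (S.continuousOn_op t x).inner (𝕜 := ℝ) (S.continuousOn_op t w)
  have hder : ∀ s ∈ Ico 0 t,
      HasDerivWithinAt (fun s => ⟪S.op s x, S.op s w⟫_ℝ) 0 (Ici s) s := by
    intro s hs
    have h1 := (hxz.hasDerivWithinAt hs.1).inner ℝ (hwv.hasDerivWithinAt hs.1)
    have h2 := (hS (S.op s w) (-S.op s v)).1 (by
      rw [smul_neg, neg_smul, one_smul, neg_neg]; exact hwv.op hs.1) _ _ (hxz.op hs.1)
    have h3 : ⟪S.op s x, S.op s v⟫_ℝ + ⟪S.op s z, S.op s w⟫_ℝ = 0 := by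
      rw [h2, inner_neg_right]
      ring
    rw [h3] at h1
    exact h1
  have := constant_of_has_deriv_right_zero hcont hder t ⟨ht, le_rfl⟩
  simpa [S.op_zero] using this

theorem adjoint_op_op (hS : S.HasScaledAdjoint (-1)) {t : ℝ} (ht : 0 ≤ t) (x : X) :
    (S.op t).adjoint (S.op t x) = x :=
  ext_inner_right ℝ fun w => by
    rw [ContinuousLinearMap.adjoint_inner_left, inner_op_op hS ht]

/-- Surjectivity of the isometry: `S(t)^*` commutes with the generator, hence with `S(t)`, so the
left inverse is also a right inverse. -/
theorem op_adjoint_op (hS : S.HasScaledAdjoint (-1)) {t : ℝ} (ht : 0 ≤ t) (x : X) :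
    S.op t ((S.op t).adjoint x) = x := by
  rw [← S.op_comm_of_gen_comm (fun a b hab => hab.adjoint_op (by norm_num) hS ht) ht,
    adjoint_op_op hS ht]

/-- `Ring.inverse` defaults to `0` off the units, so invertibility has to be exhibited before
`e^{-At}` has its intended meaning. -/
theorem ringInverse_op (hS : S.HasScaledAdjoint (-1)) {t : ℝ} (ht : 0 ≤ t) :
    Ring.inverse (S.op t) = (S.op t).adjoint :=
  Ring.inverse_unit (⟨S.op t, (S.op t).adjoint,
    ContinuousLinearMap.ext fun x => op_adjoint_op hS ht x,
    ContinuousLinearMap.ext fun x => adjoint_op_op hS ht x⟩ : (X →L[ℝ] X)ˣ)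

/-- In the skew case `‖S(t)^*x - x‖ = ‖S(t)(S(t)^*x - x)‖ = ‖x - S(t)x‖`. -/
theorem tendsto_adjoint_op (hS : S.HasScaledAdjoint 1 ∨ S.HasScaledAdjoint (-1)) (x : X) :
    Tendsto (fun t => (S.op t).adjoint x) (𝓝[>] 0) (𝓝 x) := by
  rcases hS with hS | hS
  · refine (S.tendsto_zero x).congr' ?_
    filter_upwards [self_mem_nhdsWithin] with t ht
    rw [adjoint_op_eq hS (le_of_lt ht)]
  · rw [tendsto_iff_norm_sub_tendsto_zero]
    have h1 := ((S.tendsto_zero x).sub_const x).norm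
    rw [sub_self, norm_zero] at h1
    refine h1.congr' ?_
    filter_upwards [self_mem_nhdsWithin] with t ht
    have ht' : (0 : ℝ) ≤ t := le_of_lt ht
    have h2 : ∀ v, ‖S.op t v‖ = ‖v‖ := fun v => by
      rw [@norm_eq_sqrt_real_inner _ _ _ (S.op t v), inner_op_op hS ht', ← norm_eq_sqrt_real_inner]
    rw [← h2 ((S.op t).adjoint x - x), map_sub, op_adjoint_op hS ht', norm_sub_rev]

/-- The adjoint semigroup. -/
noncomputable def adj (S : C0Semigroup X)
    (hS : ∀ x, Tendsto (fun t => (S.op t).adjoint x) (𝓝[>] 0) (𝓝 x)) : C0Semigroup X where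
  op t := (S.op t).adjoint
  op_zero := by rw [S.op_zero]; exact star_one (X →L[ℝ] X)
  op_add s t hs ht := by
    rw [add_comm, S.op_add t s ht hs, ContinuousLinearMap.adjoint_comp]
  tendsto_zero := hS

end C0Semigroup

/-! ### Measurability of operator-valued functions. -/

section Measurability

/-- `B` is measurable only pointwise on vectors, not in operator norm, so joint continuity of
evaluation is unavailable; simple functions approximate `f` instead. -/
theorem aestronglyMeasurable_clm_apply {α E F : Type*} [MeasurableSpace α] {μ : Measure α}
    [NormedAddCommGroup E] [NormedSpace ℝ E] [NormedAddCommGroup F] [NormedSpace ℝ F]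
    {B : α → E →L[ℝ] F} (hB : ∀ x, AEStronglyMeasurable (fun s => B s x) μ) {f : α → E}
    (hf : AEStronglyMeasurable f μ) : AEStronglyMeasurable (fun s => B s (f s)) μ := by
  have hsimple : ∀ g : SimpleFunc α E, AEStronglyMeasurable (fun s => B s (g s)) μ := by
    intro g
    induction g using SimpleFunc.induction with
    | @const c s hs =>
      refine ((hB c).indicator hs).congr (Eventually.of_forall fun x => ?_)
      by_cases hx : x ∈ s <;> simp [hx]
    | @add f g _ hf hg =>
      refine (hf.add hg).congr (Eventually.of_forall fun x => ?_)
      simp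
  obtain ⟨f', hf', hff'⟩ := hf
  refine AEStronglyMeasurable.congr (f := fun s => B s (f' s)) ?_
    (hff'.mono fun s hs => by simp only [hs])
  refine aestronglyMeasurable_of_tendsto_ae (u := atTop) (f := fun n s => B s (hf'.approx n s))
    (fun n => hsimple _) (Eventually.of_forall fun s => ?_)
  exact ((B s).continuous.tendsto _).comp (hf'.tendsto_approx s)

/-- Weakly measurable functions with values in a separable Hilbert space are strongly
measurable. -/
theorem aestronglyMeasurable_of_inner {α X : Type*} [MeasurableSpace α] {μ : Measure α}
    [NormedAddCommGroup X] [InnerProductSpace ℝ X] [CompleteSpace X]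
    [TopologicalSpace.SeparableSpace X] {f : α → X}
    (hf : ∀ x, AEStronglyMeasurable (fun s => ⟪x, f s⟫_ℝ) μ) : AEStronglyMeasurable f μ := by
  obtain ⟨w, b, -⟩ := exists_hilbertBasis ℝ X
  have hw : Countable w := by
    -- Distinct basis vectors lie at distance `√2 > 1`, so the balls of radius `1/2` are disjoint,
    -- and separability allows only countably many.
    refine Pairwise.countable_of_isOpen_disjoint (s := fun i => Metric.ball (b i) (1 / 2))
      (fun i j hij => Metric.ball_disjoint_ball ?_) (fun i => Metric.isOpen_ball)
      (fun i => ⟨b i, Metric.mem_ball_self (by norm_num)⟩)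
    have h1 : ‖b i - b j‖ ^ 2 = 2 := by
      rw [norm_sub_sq_real, b.orthonormal.1 i, b.orthonormal.1 j, b.orthonormal.2 hij]
      norm_num
    rw [dist_eq_norm]
    nlinarith [norm_nonneg (b i - b j)]
  refine aestronglyMeasurable_of_tendsto_ae (u := (atTop : Filter (Finset w)))
    (f := fun n s => ∑ i ∈ n, ⟪b i, f s⟫_ℝ • b i) (fun n => ?_) (Eventually.of_forall fun s => ?_)
  · exact Finset.aestronglyMeasurable_fun_sum _ fun i _ => (hf (b i)).smul_const (b i)
  · have := b.hasSum_repr (f s)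
    simpa [HasSum, b.repr_apply_apply] using this

end Measurability

/-! ### Negligible functions of two times and summation over partitions. -/

/-- The set of `(t, s, t')` with `0 ≤ t ≤ s ≤ t' ≤ T`. -/
def timeSimplex (T : ℝ) : Set (ℝ × ℝ × ℝ) :=
  {p | 0 ≤ p.1 ∧ p.1 ≤ p.2.1 ∧ p.2.1 ≤ p.2.2 ∧ p.2.2 ≤ T}

theorem isCompact_timeSimplex (T : ℝ) : IsCompact (timeSimplex T) := by
  refine IsCompact.of_isClosed_subset (isCompact_Icc (a := ((0, 0, 0) : ℝ × ℝ × ℝ))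
    (b := (T, T, T))) ?_ ?_
  · refine (isClosed_le continuous_const continuous_fst).inter
      ((isClosed_le continuous_fst (continuous_fst.comp continuous_snd)).inter
        ((isClosed_le (continuous_fst.comp continuous_snd)
          (continuous_snd.comp continuous_snd)).inter
            (isClosed_le (continuous_snd.comp continuous_snd) continuous_const)))
  · rintro ⟨t, s, t'⟩ ⟨h1, h2, h3, h4⟩
    simp only at h1 h2 h3 h4
    refine ⟨⟨h1, ?_, ?_⟩, ⟨?_, ?_, h4⟩⟩ <;> simp only <;> linarith

/-- Uniform continuity on the compact simplex: every coordinate of `(t,s,t')` is within `t' - t` of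
`s`. -/
theorem exists_norm_sub_diag_lt {E : Type*} [NormedAddCommGroup E] {T : ℝ} {Φ : ℝ × ℝ × ℝ → E}
    (hΦ : ContinuousOn Φ (timeSimplex T)) {ε : ℝ} (hε : 0 < ε) :
    ∃ δ > 0, ∀ t s t', (t, s, t') ∈ timeSimplex T → t' - t < δ →
      ‖Φ (t, s, t') - Φ (s, s, s)‖ < ε := by
  have h := (isCompact_timeSimplex T).uniformContinuousOn_of_continuous hΦ
  obtain ⟨δ, hδ, h⟩ := Metric.uniformContinuousOn_iff.1 h ε hε
  refine ⟨δ, hδ, fun t s t' hp hd => ?_⟩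
  rw [← dist_eq_norm]
  obtain ⟨h1, h2, h3, h4⟩ := hp
  simp only at h1 h2 h3 h4
  refine h _ ⟨h1, h2, h3, h4⟩ _ ⟨h1.trans h2, le_rfl, le_rfl, h3.trans h4⟩ ?_
  rw [Prod.dist_eq, Prod.dist_eq, Real.dist_eq, Real.dist_eq, Real.dist_eq]
  refine max_lt ?_ (max_lt ?_ ?_) <;> simp only <;> rw [abs_lt] <;> constructor <;> linarith

/-- A function of two times `t ≤ t'` in `[0,T]` whose sum over the partitions of `[0,T]` tends to
zero with their mesh. -/
def IsNegligible (T : ℝ) (e : ℝ → ℝ → ℝ) : Prop :=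
  ∀ ε > 0, ∃ δ > 0, ∃ m : ℝ → ℝ, IntervalIntegrable m volume 0 T ∧ ∫ s in (0 : ℝ)..T, m s ≤ ε ∧
    ∀ t t', 0 ≤ t → t ≤ t' → t' ≤ T → t' - t < δ → |e t t'| ≤ ∫ s in t..t', m s

theorem IntervalIntegrable.mono_Icc {E : Type*} [NormedAddCommGroup E] {f : ℝ → E} {T t t' : ℝ}
    (hf : IntervalIntegrable f volume 0 T) (h0 : 0 ≤ t) (h1 : t ≤ t') (h2 : t' ≤ T) :
    IntervalIntegrable f volume t t' := by
  refine hf.mono_set ?_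
  rw [uIcc_of_le h1, uIcc_of_le (h0.trans (h1.trans h2))]
  exact Icc_subset_Icc h0 h2

namespace IsNegligible

variable {T : ℝ} {e e' : ℝ → ℝ → ℝ}

theorem add (h : IsNegligible T e) (h' : IsNegligible T e') :
    IsNegligible T (fun t t' => e t t' + e' t t') := by
  intro ε hε
  obtain ⟨δ, hδ, m, hm, hmε, hb⟩ := h (ε / 2) (half_pos hε)
  obtain ⟨δ', hδ', m', hm', hmε', hb'⟩ := h' (ε / 2) (half_pos hε)
  refine ⟨min δ δ', lt_min hδ hδ', fun s => m s + m' s, hm.add hm', ?_, ?_⟩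
  · rw [intervalIntegral.integral_add hm hm']; linarith
  · intro t t' h0 h1 h2 hd
    rw [intervalIntegral.integral_add (hm.mono_Icc h0 h1 h2) (hm'.mono_Icc h0 h1 h2)]
    exact (abs_add_le _ _).trans (add_le_add (hb t t' h0 h1 h2 (hd.trans_le (min_le_left _ _)))
      (hb' t t' h0 h1 h2 (hd.trans_le (min_le_right _ _))))

theorem neg (h : IsNegligible T e) : IsNegligible T (fun t t' => -e t t') := by
  simpa only [IsNegligible, abs_neg] using h

theorem sub (h : IsNegligible T e) (h' : IsNegligible T e') :
    IsNegligible T (fun t t' => e t t' - e' t t') := by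
  simpa only [sub_eq_add_neg] using h.add h'.neg

theorem congr (h : IsNegligible T e)
    (hee' : ∀ t t', 0 ≤ t → t ≤ t' → t' ≤ T → e' t t' = e t t') : IsNegligible T e' := by
  intro ε hε
  obtain ⟨δ, hδ, m, hm, hmε, hb⟩ := h ε hε
  exact ⟨δ, hδ, m, hm, hmε, fun t t' h0 h1 h2 hd => by
    rw [hee' t t' h0 h1 h2]; exact hb t t' h0 h1 h2 hd⟩

/-- If the increments of `h` agree with the integrals of `g` up to a negligible error, then they
agree. -/
theorem sub_eq_integral {h g : ℝ → ℝ} (hT : 0 < T) (hg : IntervalIntegrable g volume 0 T)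
    (hh : IsNegligible T (fun t t' => h t' - h t - ∫ s in t..t', g s)) :
    h T - h 0 = ∫ s in (0 : ℝ)..T, g s := by
  rw [← sub_eq_zero, ← abs_eq_zero]
  refine le_antisymm (le_of_forall_pos_le_add fun ε hε => ?_) (abs_nonneg _)
  obtain ⟨δ, hδ, m, hm, hmε, hb⟩ := hh ε hε
  -- The uniform partition into `n > T/δ` pieces has mesh below `δ`.
  obtain ⟨n, hn⟩ := exists_nat_gt (T / δ)
  have hn0 : (0 : ℝ) < n := (div_pos hT hδ).trans hn
  set a : ℕ → ℝ := fun i => i * (T / n)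
  have ha0 : a 0 = 0 := by simp [a]
  have han : a n = T := by simp only [a]; field_simp
  have hstep : ∀ i, a (i + 1) - a i = T / n := fun i => by simp only [a]; push_cast; ring
  have hTn : 0 < T / n := div_pos hT hn0
  have hnonneg : ∀ i, 0 ≤ a i := fun i => by simp only [a]; positivity
  have hle : ∀ i < n, a (i + 1) ≤ T := fun i hi => by
    rw [← han]; simp only [a]
    exact mul_le_mul_of_nonneg_right (by exact_mod_cast hi) hTn.le
  have hsm : ∀ i, a i ≤ a (i + 1) := fun i => by linarith [hstep i]
  have hδn : T / n < δ := by rw [div_lt_iff₀ hn0]; rwa [div_lt_iff₀ hδ, mul_comm] at hn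
  have s1 := intervalIntegral.sum_integral_adjacent_intervals (f := g) (μ := volume) (a := a)
    (n := n) fun i hi => hg.mono_Icc (hnonneg i) (hsm i) (hle i hi)
  have s2 := intervalIntegral.sum_integral_adjacent_intervals (f := m) (μ := volume) (a := a)
    (n := n) fun i hi => hm.mono_Icc (hnonneg i) (hsm i) (hle i hi)
  have s3 := Finset.sum_range_sub (fun i => h (a i)) n
  rw [ha0, han] at s1 s2 s3
  rw [← s1, ← s3, ← Finset.sum_sub_distrib, zero_add]
  calc |∑ i ∈ Finset.range n, (h (a (i + 1)) - h (a i) - ∫ s in a i..a (i + 1), g s)|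
      ≤ ∑ i ∈ Finset.range n, |h (a (i + 1)) - h (a i) - ∫ s in a i..a (i + 1), g s| :=
        Finset.abs_sum_le_sum_abs _ _
    _ ≤ ∑ i ∈ Finset.range n, ∫ s in a i..a (i + 1), m s := by
        refine Finset.sum_le_sum fun i hi => ?_
        exact hb _ _ (hnonneg i) (hsm i) (hle i (Finset.mem_range.1 hi)) (by rwa [hstep])
    _ ≤ ε := by rw [s2]; exact hmε

/-- A bound of the integrands by `m(s)`, uniform in the endpoints `t`, `t'`, integrates to the bound
that negligibility requires. -/
theorem integral_sub_integral {k : ℝ × ℝ × ℝ → ℝ} {k₀ : ℝ → ℝ}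
    (hk : ∀ t t', 0 ≤ t → t ≤ t' → t' ≤ T →
      IntervalIntegrable (fun s => k (t, s, t')) volume t t')
    (hk₀ : IntervalIntegrable k₀ volume 0 T)
    (h : ∀ ε > 0, ∃ δ > 0, ∃ m : ℝ → ℝ, IntervalIntegrable m volume 0 T ∧
      ∫ s in (0 : ℝ)..T, m s ≤ ε ∧ ∀ᵐ s, s ∈ Icc 0 T → ∀ t t', (t, s, t') ∈ timeSimplex T →
        t' - t < δ → |k (t, s, t') - k₀ s| ≤ m s) :
    IsNegligible T (fun t t' => (∫ s in t..t', k (t, s, t')) - ∫ s in t..t', k₀ s) := by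
  intro ε hε
  obtain ⟨δ, hδ, m, hm, hmε, hb⟩ := h ε hε
  refine ⟨δ, hδ, m, hm, hmε, fun t t' h0 h1 h2 hd => ?_⟩
  beta_reduce
  rw [← intervalIntegral.integral_sub (hk t t' h0 h1 h2) (hk₀.mono_Icc h0 h1 h2),
    ← Real.norm_eq_abs]
  refine intervalIntegral.norm_integral_le_of_norm_le h1 ?_ (hm.mono_Icc h0 h1 h2)
  filter_upwards [hb] with s hs hst
  exact hs ⟨h0.trans hst.1.le, hst.2.trans h2⟩ t t' ⟨h0, hst.1.le, hst.2, h2⟩ hd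

end IsNegligible

/-! ### Integrability, and freezing kernels on the diagonal. -/

section Integrability

variable {E F : Type*} [NormedAddCommGroup E] [NormedSpace ℝ E]
  [NormedAddCommGroup F] [NormedSpace ℝ F]

theorem intervalIntegrable_clm_apply {L : ℝ → E →L[ℝ] F} {f : ℝ → E} {a b C : ℝ} (hab : a ≤ b)
    (hL : ∀ x, AEStronglyMeasurable (fun s => L s x) (volume.restrict (Icc a b)))
    (hC : ∀ᵐ s ∂(volume.restrict (Icc a b)), ‖L s‖ ≤ C) (hf : IntervalIntegrable f volume a b) :
    IntervalIntegrable (fun s => L s (f s)) volume a b := by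
  rw [intervalIntegrable_iff_integrableOn_Icc_of_le hab] at hf ⊢
  refine Integrable.mono' (g := fun s => C * ‖f s‖) (hf.norm.const_mul C)
    (aestronglyMeasurable_clm_apply hL hf.aestronglyMeasurable) ?_
  filter_upwards [hC] with s hs
  exact (L s).le_of_opNorm_le hs _

theorem intervalIntegrable_clm_apply_of_continuousOn [CompleteSpace E] {L : ℝ → E →L[ℝ] F}
    {f : ℝ → E} {a b : ℝ} (hab : a ≤ b) (hL : ∀ x, ContinuousOn (fun s => L s x) (Icc a b))
    (hf : IntervalIntegrable f volume a b) :
    IntervalIntegrable (fun s => L s (f s)) volume a b := by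
  obtain ⟨C, -, hC⟩ := exists_norm_le_of_isCompact isCompact_Icc hL
  exact intervalIntegrable_clm_apply hab
    (fun x => (hL x).aestronglyMeasurable measurableSet_Icc)
    ((ae_restrict_iff' measurableSet_Icc).2 (Eventually.of_forall hC)) hf

theorem continuousOn_timeSimplex_slice {Y : Type*} [TopologicalSpace Y] {T t t' : ℝ}
    {Φ : ℝ × ℝ × ℝ → Y} (hΦ : ContinuousOn Φ (timeSimplex T)) (h0 : 0 ≤ t) (h2 : t' ≤ T) :
    ContinuousOn (fun s => Φ (t, s, t')) (Icc t t') :=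
  hΦ.comp (f := fun s => (t, s, t')) (by fun_prop) fun _ hs => ⟨h0, hs.1, hs.2, h2⟩

theorem continuousOn_timeSimplex_diag {Y : Type*} [TopologicalSpace Y] {T : ℝ}
    {Φ : ℝ × ℝ × ℝ → Y} (hΦ : ContinuousOn Φ (timeSimplex T)) :
    ContinuousOn (fun s => Φ (s, s, s)) (Icc 0 T) :=
  hΦ.comp (f := fun s => (s, s, s)) (by fun_prop) fun _ hs => ⟨hs.1, le_rfl, le_rfl, hs.2⟩

/-- In `∫ₜ^t' L(t,s,t') f(s) ds` with `L` strongly continuous and `f` integrable, `L(t,s,t')` may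
be replaced by `L(s,s,s)`. -/
theorem isNegligible_integral_clm_apply [CompleteSpace E] {T : ℝ} (hT : 0 ≤ T)
    {L : ℝ × ℝ × ℝ → E →L[ℝ] ℝ} (hL : ∀ x, ContinuousOn (fun p => L p x) (timeSimplex T))
    {f : ℝ → E} (hf : IntervalIntegrable f volume 0 T) :
    IsNegligible T (fun t t' =>
      (∫ s in t..t', L (t, s, t') (f s)) - ∫ s in t..t', L (s, s, s) (f s)) := by
  obtain ⟨C, hC0, hC⟩ := exists_norm_le_of_isCompact (isCompact_timeSimplex T) hL
  refine IsNegligible.integral_sub_integral (k := fun p => L p (f p.2.1))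
    (fun t t' h0 h1 h2 => intervalIntegrable_clm_apply_of_continuousOn h1
      (fun x => continuousOn_timeSimplex_slice (hL x) h0 h2) (hf.mono_Icc h0 h1 h2))
    (intervalIntegrable_clm_apply_of_continuousOn hT
      (fun x => continuousOn_timeSimplex_diag (hL x)) hf) ?_
  intro ε hε
  -- The total error is `2Cη` from the `L¹` approximation plus `Tη` from uniform continuity; the `1`
  -- keeps the denominator positive.
  set η := ε / (2 * C + T + 1)
  have hη : 0 < η := by positivity
  have hf' := (intervalIntegrable_iff_integrableOn_Ioc_of_le hT).1 hf
  -- `L` is only strongly continuous and `f` only integrable, so `L(t,s,t')f(s)` need not be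
  -- uniformly close to its diagonal value. A continuous `g` near `f` in `L¹` makes `p ↦ L(p) g(s)`
  -- jointly continuous.
  obtain ⟨g, -, hfg, hg, hgi⟩ := Integrable.exists_hasCompactSupport_integral_sub_le hf' hη
  obtain ⟨δ, hδ, hΦ⟩ := exists_norm_sub_diag_lt (continuousOn_clm_apply_of_bounded hC hL
    (w := fun p => g p.2.1) (by fun_prop)) hη
  have hgi' : IntervalIntegrable g volume 0 T :=
    (intervalIntegrable_iff_integrableOn_Ioc_of_le hT).2 hgi
  have hn : IntervalIntegrable (fun s => ‖f s - g s‖) volume 0 T := (hf.sub hgi').norm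
  refine ⟨δ, hδ, fun s => 2 * C * ‖f s - g s‖ + η, (hn.const_mul _).add (by simp), ?_, ?_⟩
  · rw [intervalIntegral.integral_add (hn.const_mul _) (by simp),
      intervalIntegral.integral_const_mul, intervalIntegral.integral_of_le hT]
    simp only [intervalIntegral.integral_const, sub_zero, smul_eq_mul]
    have h1 : 2 * C * (∫ s in Ioc 0 T, ‖f s - g s‖) ≤ 2 * C * η :=
      mul_le_mul_of_nonneg_left hfg (by positivity)
    have h2 : ε = (2 * C + T + 1) * η := by simp only [η]; field_simp
    nlinarith
  · refine Eventually.of_forall fun s hs t t' hp hd => ?_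
    have h1 := hΦ t s t' hp hd
    have hps : (s, s, s) ∈ timeSimplex T := ⟨hs.1, le_rfl, le_rfl, hs.2⟩
    have e1 : L (t, s, t') (f s) - L (s, s, s) (f s) = L (t, s, t') (f s - g s)
        - L (s, s, s) (f s - g s) + (L (t, s, t') (g s) - L (s, s, s) (g s)) := by
      simp only [map_sub]; ring
    have h2 := (L (t, s, t')).le_of_opNorm_le (hC _ hp) (f s - g s)
    have h3 := (L (s, s, s)).le_of_opNorm_le (hC _ hps) (f s - g s)
    simp only [Real.norm_eq_abs] at h1 h2 h3
    rw [e1, abs_le]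
    rw [abs_lt] at h1
    rw [abs_le] at h2 h3
    constructor <;> linarith

end Integrability

/-! ### Calculus of essentially bounded, strongly measurable families. -/

section Linfty

variable {X : Type*} [NormedAddCommGroup X] [InnerProductSpace ℝ X] {T : ℝ}

theorem IsStronglyContinuousOp.isLinftyOp [CompleteSpace X] {F : ℝ → X →L[ℝ] X}
    (hF : IsStronglyContinuousOp T F) : IsLinftyOp T F := by
  obtain ⟨C, -, hC⟩ := exists_norm_le_of_isCompact isCompact_Icc hF
  exact ⟨fun x => (hF x).aestronglyMeasurable measurableSet_Icc,
    C, (ae_restrict_iff' measurableSet_Icc).2 (Eventually.of_forall hC)⟩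

namespace IsLinftyOp

variable {B B' : ℝ → X →L[ℝ] X}

theorem add (h : IsLinftyOp T B) (h' : IsLinftyOp T B') : IsLinftyOp T (fun t => B t + B' t) := by
  obtain ⟨K, hK⟩ := h.bdd
  obtain ⟨K', hK'⟩ := h'.bdd
  refine ⟨fun x => (h.meas x).add (h'.meas x), K + K', ?_⟩
  filter_upwards [hK, hK'] with t h1 h2
  exact (norm_add_le _ _).trans (add_le_add h1 h2)

theorem neg (h : IsLinftyOp T B) : IsLinftyOp T (fun t => -B t) := by
  obtain ⟨K, hK⟩ := h.bdd
  refine ⟨fun x => (h.meas x).neg, K, ?_⟩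
  filter_upwards [hK] with t h1
  rwa [norm_neg]

theorem sub (h : IsLinftyOp T B) (h' : IsLinftyOp T B') : IsLinftyOp T (fun t => B t - B' t) := by
  simpa only [sub_eq_add_neg] using h.add h'.neg

theorem mul (h : IsLinftyOp T B) (h' : IsLinftyOp T B') : IsLinftyOp T (fun t => B t * B' t) := by
  obtain ⟨K, hK⟩ := h.bdd
  obtain ⟨K', hK'⟩ := h'.bdd
  refine ⟨fun x => aestronglyMeasurable_clm_apply h.meas (h'.meas x), K * K', ?_⟩
  filter_upwards [hK, hK'] with t h1 h2
  exact (norm_mul_le _ _).trans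
    (mul_le_mul h1 h2 (norm_nonneg _) ((norm_nonneg _).trans h1))

/-- Strong measurability of `B` gives only weak measurability of `B^*`; separability of `X` upgrades
it. -/
theorem adjoint [CompleteSpace X] [TopologicalSpace.SeparableSpace X] (h : IsLinftyOp T B) :
    IsLinftyOp T (fun t => (B t).adjoint) := by
  obtain ⟨K, hK⟩ := h.bdd
  refine ⟨fun x => aestronglyMeasurable_of_inner fun w => ?_, K, ?_⟩
  · simp only [ContinuousLinearMap.adjoint_inner_right]
    exact (h.meas w).inner (𝕜 := ℝ) aestronglyMeasurable_const
  · filter_upwards [hK] with t h1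
    rwa [LinearIsometryEquiv.norm_map]

theorem comp_sub_left (h : IsLinftyOp T B) : IsLinftyOp T (fun t => B (T - t)) := by
  have hmp : MeasurePreserving (fun t : ℝ => T - t) (volume.restrict (Icc 0 T))
      (volume.restrict (Icc 0 T)) := by
    have h1 := (Measure.measurePreserving_sub_left (volume : Measure ℝ) T).restrict_preimage
      (measurableSet_Icc (a := (0 : ℝ)) (b := T))
    have h2 : (fun t : ℝ => T - t) ⁻¹' Icc 0 T = Icc 0 T := by
      ext t; simp only [mem_preimage, mem_Icc]; constructor <;> rintro ⟨a, b⟩ <;> constructor <;>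
        linarith
    rwa [h2] at h1
  obtain ⟨K, hK⟩ := h.bdd
  exact ⟨fun x => (h.meas x).comp_measurePreserving hmp, K, hmp.quasiMeasurePreserving.ae hK⟩

theorem mono (h : IsLinftyOp T B) {a b : ℝ} (ha : 0 ≤ a) (hb : b ≤ T) :
    (∀ x, AEStronglyMeasurable (fun s => B s x) (volume.restrict (Icc a b))) ∧
      ∃ K, ∀ᵐ s ∂(volume.restrict (Icc a b)), ‖B s‖ ≤ K := by
  have hr : volume.restrict (Icc a b) ≤ volume.restrict (Icc 0 T) :=
    Measure.restrict_mono (Icc_subset_Icc ha hb) le_rfl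
  obtain ⟨K, hK⟩ := h.bdd
  exact ⟨fun x => (h.meas x).mono_measure hr, K, ae_mono hr hK⟩

theorem intervalIntegrable_apply (h : IsLinftyOp T B) {f : ℝ → X} {a b : ℝ} (ha : 0 ≤ a)
    (hab : a ≤ b) (hb : b ≤ T) (hf : IntervalIntegrable f volume a b) :
    IntervalIntegrable (fun s => B s (f s)) volume a b := by
  obtain ⟨h1, K, h2⟩ := h.mono ha hb
  exact intervalIntegrable_clm_apply hab h1 h2 hf

end IsLinftyOp

theorem IntervalIntegrable.inner_continuousOn [CompleteSpace X] {f g : ℝ → X} {a b : ℝ}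
    (hab : a ≤ b) (hf : IntervalIntegrable f volume a b) (hg : ContinuousOn g (Icc a b)) :
    IntervalIntegrable (fun s => ⟪f s, g s⟫_ℝ) volume a b := by
  refine IntervalIntegrable.congr (f := fun s => ⟪g s, f s⟫_ℝ)
    (fun s _ => real_inner_comm _ _) ?_
  exact intervalIntegrable_clm_apply_of_continuousOn (L := fun s => innerSL ℝ (g s)) hab
    (fun x => hg.inner (𝕜 := ℝ) continuousOn_const) hf

/-- In `∫ₜ^t' ⟪K(s) a(t,s,t'), b(t,s,t')⟫ ds` the arguments `(t,s,t')` may be replaced by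
`(s,s,s)`. -/
theorem isNegligible_integral_inner [CompleteSpace X] (hT : 0 ≤ T) {K : ℝ → X →L[ℝ] X}
    (hK : IsLinftyOp T K) {a b : ℝ × ℝ × ℝ → X} (ha : ContinuousOn a (timeSimplex T))
    (hb : ContinuousOn b (timeSimplex T)) :
    IsNegligible T (fun t t' => (∫ s in t..t', ⟪K s (a (t, s, t')), b (t, s, t')⟫_ℝ)
      - ∫ s in t..t', ⟪K s (a (s, s, s)), b (s, s, s)⟫_ℝ) := by
  obtain ⟨Ca, hCa⟩ := (isCompact_timeSimplex T).exists_bound_of_continuousOn ha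
  obtain ⟨Cb, hCb⟩ := (isCompact_timeSimplex T).exists_bound_of_continuousOn hb
  obtain ⟨C, hC⟩ := hK.bdd
  refine IsNegligible.integral_sub_integral (k := fun p => ⟪K p.2.1 (a p), b p⟫_ℝ)
    (fun t t' h0 h1 h2 => ?_) ?_ ?_
  · have ha' := continuousOn_timeSimplex_slice ha h0 h2
    exact (hK.intervalIntegrable_apply h0 h1 h2
      (ContinuousOn.intervalIntegrable_of_Icc h1 ha')).inner_continuousOn h1
      (continuousOn_timeSimplex_slice hb h0 h2)
  · exact (hK.intervalIntegrable_apply le_rfl hT le_rfl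
      (ContinuousOn.intervalIntegrable_of_Icc hT
        (continuousOn_timeSimplex_diag ha))).inner_continuousOn hT
        (continuousOn_timeSimplex_diag hb)
  · intro ε hε
    -- `K(s)` is already at time `s`, so only the two arguments vary, each by at most `ε/D`; the `+
    -- 1` makes `D` positive.
    set D := (|C| * |Cb| + |C| * |Ca|) * T + 1
    have hD : 0 < D := by positivity
    have hη : 0 < ε / D := by positivity
    obtain ⟨δ, hδ, hδa⟩ := exists_norm_sub_diag_lt ha hη
    obtain ⟨δ', hδ', hδb⟩ := exists_norm_sub_diag_lt hb hη
    refine ⟨min δ δ', lt_min hδ hδ', fun s => (|C| * |Cb| + |C| * |Ca|) * (ε / D), by simp, ?_, ?_⟩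
    · simp only [intervalIntegral.integral_const, sub_zero, smul_eq_mul]
      calc T * ((|C| * |Cb| + |C| * |Ca|) * (ε / D))
          = ((|C| * |Cb| + |C| * |Ca|) * T) * (ε / D) := by ring
        _ ≤ D * (ε / D) := mul_le_mul_of_nonneg_right (by simp [D]) hη.le
        _ = ε := by field_simp
    · filter_upwards [(ae_restrict_iff' measurableSet_Icc).1 hC] with s hs hsT t t' hp hd
      have hps : (s, s, s) ∈ timeSimplex T := ⟨hsT.1, le_rfl, le_rfl, hsT.2⟩
      have h1 := (hδa t s t' hp (hd.trans_le (min_le_left _ _))).le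
      have h2 := (hδb t s t' hp (hd.trans_le (min_le_right _ _))).le
      have hKs : ‖K s‖ ≤ |C| := (hs hsT).trans (le_abs_self C)
      have e1 : ⟪K s (a (t, s, t')), b (t, s, t')⟫_ℝ - ⟪K s (a (s, s, s)), b (s, s, s)⟫_ℝ
          = ⟪K s (a (t, s, t') - a (s, s, s)), b (t, s, t')⟫_ℝ
            + ⟪K s (a (s, s, s)), b (t, s, t') - b (s, s, s)⟫_ℝ := by
        simp only [map_sub, inner_sub_left, inner_sub_right]; ring
      rw [e1]
      refine (abs_add_le _ _).trans ?_
      rw [add_mul]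
      refine add_le_add ?_ ?_
      · refine (abs_real_inner_le_norm _ _).trans ?_
        rw [mul_right_comm]
        exact mul_le_mul (((K s).le_of_opNorm_le hKs _).trans
          (mul_le_mul_of_nonneg_left h1 (abs_nonneg _))) ((hCb _ hp).trans (le_abs_self _))
          (norm_nonneg _) (by positivity)
      · refine (abs_real_inner_le_norm _ _).trans ?_
        exact mul_le_mul (((K s).le_of_opNorm_le hKs _).trans
          (mul_le_mul_of_nonneg_left ((hCa _ hps).trans (le_abs_self _)) (abs_nonneg _))) h2
          (norm_nonneg _) (by positivity)

end Linfty

/-! ### Exact increments and the integral identities for quadratic and bilinear terms. -/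

section

variable {X : Type*} [NormedAddCommGroup X] [InnerProductSpace ℝ X] [CompleteSpace X]

/-- `u' = A u + φ` on `[0,T]` in the mild sense. -/
structure C0Semigroup.IsMildForward (S : C0Semigroup X) (T : ℝ) (φ u : ℝ → X) : Prop where
  cont : ContinuousOn u (Icc 0 T)
  eq : ∀ t ∈ Icc 0 T, u t = S.op t (u 0) + ∫ s in (0 : ℝ)..t, S.op (t - s) (φ s)

theorem C0Semigroup.intervalIntegrable_op_sub_left (S : C0Semigroup X) {φ : ℝ → X} {a b c : ℝ}
    (hab : a ≤ b) (hbc : b ≤ c) (hφ : IntervalIntegrable φ volume a b) :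
    IntervalIntegrable (fun s => S.op (c - s) (φ s)) volume a b :=
  intervalIntegrable_clm_apply_of_continuousOn hab
    (fun x => (S.continuousOn_op (c - a) x).comp (by fun_prop)
      fun s hs => ⟨by linarith [hs.2], by linarith [hs.1]⟩) hφ

theorem C0Semigroup.intervalIntegrable_op_sub_right (S : C0Semigroup X) {φ : ℝ → X} {a b c : ℝ}
    (hab : a ≤ b) (hca : c ≤ a) (hφ : IntervalIntegrable φ volume a b) :
    IntervalIntegrable (fun s => S.op (s - c) (φ s)) volume a b :=
  intervalIntegrable_clm_apply_of_continuousOn hab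
    (fun x => (S.continuousOn_op (b - c) x).comp (by fun_prop)
      fun s hs => ⟨by linarith [hs.1], by linarith [hs.2]⟩) hφ

/-- A mild solution may be restarted at any time `t`: apply `S(t'-t)` to the formula at `t` and use
the semigroup law under the integral. -/
theorem C0Semigroup.IsMildForward.increment {S : C0Semigroup X} {T : ℝ} {φ u : ℝ → X}
    (h : S.IsMildForward T φ u) (hφ : IntervalIntegrable φ volume 0 T) {t t' : ℝ} (h0 : 0 ≤ t)
    (h1 : t ≤ t') (h2 : t' ≤ T) :
    u t' = S.op (t' - t) (u t) + ∫ s in t..t', S.op (t' - s) (φ s) := by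
  have hφt := hφ.mono_Icc le_rfl h0 (h1.trans h2)
  rw [h.eq t ⟨h0, h1.trans h2⟩, h.eq t' ⟨h0.trans h1, h2⟩, map_add,
    ← S.op_add_apply (sub_nonneg.2 h1) h0, sub_add_cancel,
    ← ContinuousLinearMap.intervalIntegral_comp_comm _
      (S.intervalIntegrable_op_sub_left h0 le_rfl hφt), add_assoc]
  congr 1
  rw [← intervalIntegral.integral_add_adjacent_intervals
    (S.intervalIntegrable_op_sub_left h0 h1 hφt)
    (S.intervalIntegrable_op_sub_left h1 le_rfl (hφ.mono_Icc h0 h1 h2))]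
  congr 1
  refine intervalIntegral.integral_congr fun s hs => ?_
  rw [uIcc_of_le h0] at hs
  rw [← S.op_add_apply (sub_nonneg.2 h1) (sub_nonneg.2 hs.2), sub_add_sub_cancel]

/-- The identity for `⟪G u, u⟫` when `G' + G A + A^* G = K` and `u' = A u + φ`. -/
theorem quadratic_eq_integral {S : C0Semigroup X} {T : ℝ} (hT : 0 < T) {φ u : ℝ → X}
    (hu : S.IsMildForward T φ u) (hφ : IntervalIntegrable φ volume 0 T) {G K : ℝ → X →L[ℝ] X}
    (hG : IsStronglyContinuousOp T G) (hK : IsLinftyOp T K)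
    (hGK : ∀ t t', 0 ≤ t → t ≤ t' → t' ≤ T → ∀ x w,
      ⟪G t x, w⟫_ℝ = ⟪G t' (S.op (t' - t) x), S.op (t' - t) w⟫_ℝ
        - ∫ s in t..t', ⟪K s (S.op (s - t) x), S.op (s - t) w⟫_ℝ) :
    IntervalIntegrable (fun s => ⟪K s (u s), u s⟫_ℝ + ⟪u s, G s (φ s)⟫_ℝ + ⟪G s (u s), φ s⟫_ℝ)
        volume 0 T ∧
      ⟪G T (u T), u T⟫_ℝ - ⟪G 0 (u 0), u 0⟫_ℝ =
        ∫ s in (0 : ℝ)..T, (⟪K s (u s), u s⟫_ℝ + ⟪u s, G s (φ s)⟫_ℝ + ⟪G s (u s), φ s⟫_ℝ) := by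
  obtain ⟨CG, -, hCG⟩ := exists_norm_le_of_isCompact isCompact_Icc hG
  have hm1 : MapsTo (fun p : ℝ × ℝ × ℝ => p.1) (timeSimplex T) (Icc 0 T) :=
    fun p hp => ⟨hp.1, hp.2.1.trans (hp.2.2.1.trans hp.2.2.2)⟩
  have hm3 : MapsTo (fun p : ℝ × ℝ × ℝ => p.2.2) (timeSimplex T) (Icc 0 T) :=
    fun p hp => ⟨hp.1.trans (hp.2.1.trans hp.2.2.1), hp.2.2.2⟩
  have hu1 : ContinuousOn (fun p : ℝ × ℝ × ℝ => u p.1) (timeSimplex T) :=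
    hu.cont.comp (by fun_prop) hm1
  have hu3 : ContinuousOn (fun p : ℝ × ℝ × ℝ => u p.2.2) (timeSimplex T) :=
    hu.cont.comp (by fun_prop) hm3
  have hG3 : ∀ {w : ℝ × ℝ × ℝ → X}, ContinuousOn w (timeSimplex T) →
      ContinuousOn (fun p => G p.2.2 (w p)) (timeSimplex T) := fun hw =>
    continuousOn_clm_apply_of_bounded (fun p hp => hCG _ (hm3 hp))
      (fun x => (hG x).comp (f := fun p : ℝ × ℝ × ℝ => p.2.2) (by fun_prop) hm3) hw
  have hS21 : ContinuousOn (fun p : ℝ × ℝ × ℝ => S.op (p.2.1 - p.1) (u p.1)) (timeSimplex T) :=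
    S.continuousOn_op_apply T (by fun_prop)
      (fun p ⟨a, b, c, d⟩ => ⟨by linarith, by linarith⟩) hu1
  have hS31 : ContinuousOn (fun p : ℝ × ℝ × ℝ => S.op (p.2.2 - p.1) (u p.1)) (timeSimplex T) :=
    S.continuousOn_op_apply T (by fun_prop)
      (fun p ⟨a, b, c, d⟩ => ⟨by linarith, by linarith⟩) hu1
  have hS32 : ∀ x, ContinuousOn (fun p : ℝ × ℝ × ℝ => S.op (p.2.2 - p.2.1) x) (timeSimplex T) :=
    fun x => S.continuousOn_op_apply T (by fun_prop)
      (fun p ⟨a, b, c, d⟩ => ⟨by linarith, by linarith⟩) continuousOn_const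
  -- With `u' = u(t')`, `G' = G(t')`, `⟨G'u', u'⟩ - ⟨G'(u'-r), u'-r⟩ = ⟨u', G'r⟩ + ⟨G'(u'-r), r⟩`.
  -- Keeping `u'-r` as `S(t'-t)u(t)` in `L₂` makes both terms linear in `φ`, with no quadratic
  -- remainder.
  set L₁ : ℝ × ℝ × ℝ → X →L[ℝ] ℝ := fun p =>
    (innerSL ℝ (u p.2.2)).comp ((G p.2.2).comp (S.op (p.2.2 - p.2.1))) with hL₁
  set L₂ : ℝ × ℝ × ℝ → X →L[ℝ] ℝ := fun p =>
    (innerSL ℝ (G p.2.2 (S.op (p.2.2 - p.1) (u p.1)))).comp (S.op (p.2.2 - p.2.1)) with hL₂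
  have hc₁ : ∀ x, ContinuousOn (fun p => L₁ p x) (timeSimplex T) := fun x =>
    hu3.inner (𝕜 := ℝ) (hG3 (hS32 x))
  have hc₂ : ∀ x, ContinuousOn (fun p => L₂ p x) (timeSimplex T) := fun x =>
    (hG3 hS31).inner (𝕜 := ℝ) (hS32 x)
  have n₁ := isNegligible_integral_clm_apply hT.le hc₁ hφ
  have n₂ := isNegligible_integral_clm_apply hT.le hc₂ hφ
  have n₃ := isNegligible_integral_inner hT.le hK hS21 hS21
  have i₁ := intervalIntegrable_clm_apply_of_continuousOn hT.le
    (fun x => continuousOn_timeSimplex_diag (hc₁ x)) hφ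
  have i₂ := intervalIntegrable_clm_apply_of_continuousOn hT.le
    (fun x => continuousOn_timeSimplex_diag (hc₂ x)) hφ
  have i₃ : IntervalIntegrable (fun s => ⟪K s (u s), u s⟫_ℝ) volume 0 T :=
    (hK.intervalIntegrable_apply le_rfl hT.le le_rfl
      (ContinuousOn.intervalIntegrable_of_Icc hT.le hu.cont)).inner_continuousOn hT.le hu.cont
  simp only [hL₁, hL₂, ContinuousLinearMap.comp_apply, innerSL_apply_apply, sub_self, S.op_zero,
    ContinuousLinearMap.id_apply] at n₁ n₂ n₃ i₁ i₂
  have hint := (i₃.add i₁).add i₂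
  refine ⟨hint, IsNegligible.sub_eq_integral (h := fun t => ⟪G t (u t), u t⟫_ℝ) hT hint ?_⟩
  refine ((n₃.add n₁).add n₂).congr fun t t' h0 h1 h2 => ?_
  have hr := S.intervalIntegrable_op_sub_left h1 le_rfl (hφ.mono_Icc h0 h1 h2)
  have e₁ : (∫ s in t..t', ⟪u t', G t' (S.op (t' - s) (φ s))⟫_ℝ)
      = ⟪u t', G t' (∫ s in t..t', S.op (t' - s) (φ s))⟫_ℝ :=
    ContinuousLinearMap.intervalIntegral_comp_comm ((innerSL ℝ (u t')).comp (G t')) hr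
  have e₂ : (∫ s in t..t', ⟪G t' (S.op (t' - t) (u t)), S.op (t' - s) (φ s)⟫_ℝ)
      = ⟪G t' (S.op (t' - t) (u t)), ∫ s in t..t', S.op (t' - s) (φ s)⟫_ℝ :=
    ContinuousLinearMap.intervalIntegral_comp_comm (innerSL ℝ (G t' (S.op (t' - t) (u t)))) hr
  rw [intervalIntegral.integral_add ((i₃.add i₁).mono_Icc h0 h1 h2) (i₂.mono_Icc h0 h1 h2),
    intervalIntegral.integral_add (i₃.mono_Icc h0 h1 h2) (i₁.mono_Icc h0 h1 h2), e₁, e₂,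
    hGK t t' h0 h1 h2 (u t) (u t)]
  have hinc := hu.increment hφ h0 h1 h2
  set r := ∫ s in t..t', S.op (t' - s) (φ s)
  have hinc' : S.op (t' - t) (u t) = u t' - r := by rw [hinc]; abel
  rw [hinc', real_inner_comm _ (u t')]
  simp only [map_sub, inner_sub_left, inner_sub_right]
  ring

/-- The identity for `⟪G u, v⟫` when `G' + G A - A G = K`, `u' = A u + φ` and `v' = -A^* v - χ`. -/
theorem bilinear_eq_integral {S S' : C0Semigroup X} {T : ℝ} (hT : 0 < T) {φ χ u v : ℝ → X}
    (hu : S.IsMildForward T φ u) (hφ : IntervalIntegrable φ volume 0 T)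
    (hvc : ContinuousOn v (Icc 0 T)) (hχ : IntervalIntegrable χ volume 0 T)
    (hv : ∀ t t', 0 ≤ t → t ≤ t' → t' ≤ T →
      v t = S'.op (t' - t) (v t') + ∫ s in t..t', S'.op (s - t) (χ s))
    {G K : ℝ → X →L[ℝ] X} (hG : IsStronglyContinuousOp T G) (hK : IsLinftyOp T K)
    {a b : ℝ × ℝ × ℝ → X →L[ℝ] X}
    (ha : ∀ x, ContinuousOn (fun p => a p x) (timeSimplex T)) (ha1 : ∀ s x, a (s, s, s) x = x)
    (hb : ∀ x, ContinuousOn (fun p => b p x) (timeSimplex T)) (hb1 : ∀ s x, b (s, s, s) x = x)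
    (hGK : ∀ t t', 0 ≤ t → t ≤ t' → t' ≤ T → ∀ x w,
      ⟪G t' (S.op (t' - t) x), w⟫_ℝ - ⟪G t x, S'.op (t' - t) w⟫_ℝ =
        ∫ s in t..t', ⟪K s (a (t, s, t') x), b (t, s, t') w⟫_ℝ) :
    IntervalIntegrable (fun s => ⟪K s (u s), v s⟫_ℝ + ⟪v s, G s (φ s)⟫_ℝ - ⟪G s (u s), χ s⟫_ℝ)
        volume 0 T ∧
      ⟪G T (u T), v T⟫_ℝ - ⟪G 0 (u 0), v 0⟫_ℝ =
        ∫ s in (0 : ℝ)..T, (⟪K s (u s), v s⟫_ℝ + ⟪v s, G s (φ s)⟫_ℝ - ⟪G s (u s), χ s⟫_ℝ) := by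
  obtain ⟨CG, -, hCG⟩ := exists_norm_le_of_isCompact isCompact_Icc hG
  obtain ⟨Ca, -, hCa⟩ := exists_norm_le_of_isCompact (isCompact_timeSimplex T) ha
  obtain ⟨Cb, -, hCb⟩ := exists_norm_le_of_isCompact (isCompact_timeSimplex T) hb
  have hm1 : MapsTo (fun p : ℝ × ℝ × ℝ => p.1) (timeSimplex T) (Icc 0 T) :=
    fun p hp => ⟨hp.1, hp.2.1.trans (hp.2.2.1.trans hp.2.2.2)⟩
  have hm3 : MapsTo (fun p : ℝ × ℝ × ℝ => p.2.2) (timeSimplex T) (Icc 0 T) :=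
    fun p hp => ⟨hp.1.trans (hp.2.1.trans hp.2.2.1), hp.2.2.2⟩
  have hu1 : ContinuousOn (fun p : ℝ × ℝ × ℝ => u p.1) (timeSimplex T) :=
    hu.cont.comp (by fun_prop) hm1
  have hv3 : ContinuousOn (fun p : ℝ × ℝ × ℝ => v p.2.2) (timeSimplex T) :=
    hvc.comp (by fun_prop) hm3
  have hGu1 : ContinuousOn (fun p : ℝ × ℝ × ℝ => G p.1 (u p.1)) (timeSimplex T) :=
    continuousOn_clm_apply_of_bounded (fun p hp => hCG _ (hm1 hp))
      (fun x => (hG x).comp (f := fun p : ℝ × ℝ × ℝ => p.1) (by fun_prop) hm1) hu1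
  have hGS : ∀ x, ContinuousOn (fun p : ℝ × ℝ × ℝ => G p.2.2 (S.op (p.2.2 - p.2.1) x))
      (timeSimplex T) := fun x =>
    continuousOn_clm_apply_of_bounded (fun p hp => hCG _ (hm3 hp))
      (fun x => (hG x).comp (f := fun p : ℝ × ℝ × ℝ => p.2.2) (by fun_prop) hm3)
      (S.continuousOn_op_apply T (by fun_prop)
        (fun p ⟨a, b, c, d⟩ => ⟨by linarith, by linarith⟩) continuousOn_const)
  have hS21 : ∀ x, ContinuousOn (fun p : ℝ × ℝ × ℝ => S'.op (p.2.1 - p.1) x) (timeSimplex T) :=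
    fun x => S'.continuousOn_op_apply T (by fun_prop)
      (fun p ⟨a, b, c, d⟩ => ⟨by linarith, by linarith⟩) continuousOn_const
  -- `u` is propagated forward from `t` and `v` backward from `t'`, so the forcing terms are paired
  -- with `v(t')` and with `G(t)u(t)` respectively.
  set L₁ : ℝ × ℝ × ℝ → X →L[ℝ] ℝ := fun p =>
    (innerSL ℝ (v p.2.2)).comp ((G p.2.2).comp (S.op (p.2.2 - p.2.1))) with hL₁
  set L₂ : ℝ × ℝ × ℝ → X →L[ℝ] ℝ := fun p =>
    (innerSL ℝ (G p.1 (u p.1))).comp (S'.op (p.2.1 - p.1)) with hL₂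
  have hc₁ : ∀ x, ContinuousOn (fun p => L₁ p x) (timeSimplex T) := fun x =>
    hv3.inner (𝕜 := ℝ) (hGS x)
  have hc₂ : ∀ x, ContinuousOn (fun p => L₂ p x) (timeSimplex T) := fun x =>
    hGu1.inner (𝕜 := ℝ) (hS21 x)
  have n₁ := isNegligible_integral_clm_apply hT.le hc₁ hφ
  have n₂ := isNegligible_integral_clm_apply hT.le hc₂ hχ
  have n₃ := isNegligible_integral_inner hT.le hK
    (continuousOn_clm_apply_of_bounded hCa ha hu1) (continuousOn_clm_apply_of_bounded hCb hb hv3)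
  have i₁ := intervalIntegrable_clm_apply_of_continuousOn hT.le
    (fun x => continuousOn_timeSimplex_diag (hc₁ x)) hφ
  have i₂ := intervalIntegrable_clm_apply_of_continuousOn hT.le
    (fun x => continuousOn_timeSimplex_diag (hc₂ x)) hχ
  have i₃ : IntervalIntegrable (fun s => ⟪K s (u s), v s⟫_ℝ) volume 0 T :=
    (hK.intervalIntegrable_apply le_rfl hT.le le_rfl
      (ContinuousOn.intervalIntegrable_of_Icc hT.le hu.cont)).inner_continuousOn hT.le hvc
  simp only [hL₁, hL₂, ContinuousLinearMap.comp_apply, innerSL_apply_apply, sub_self, S.op_zero,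
    S'.op_zero, ContinuousLinearMap.id_apply, ha1, hb1] at n₁ n₂ n₃ i₁ i₂
  have hint := (i₃.add i₁).sub i₂
  refine ⟨hint, IsNegligible.sub_eq_integral (h := fun t => ⟪G t (u t), v t⟫_ℝ) hT hint ?_⟩
  refine ((n₃.add n₁).sub n₂).congr fun t t' h0 h1 h2 => ?_
  have hr := S.intervalIntegrable_op_sub_left h1 le_rfl (hφ.mono_Icc h0 h1 h2)
  have hq := S'.intervalIntegrable_op_sub_right h1 le_rfl (hχ.mono_Icc h0 h1 h2)
  have e₁ : (∫ s in t..t', ⟪v t', G t' (S.op (t' - s) (φ s))⟫_ℝ)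
      = ⟪v t', G t' (∫ s in t..t', S.op (t' - s) (φ s))⟫_ℝ :=
    ContinuousLinearMap.intervalIntegral_comp_comm ((innerSL ℝ (v t')).comp (G t')) hr
  have e₂ : (∫ s in t..t', ⟪G t (u t), S'.op (s - t) (χ s)⟫_ℝ)
      = ⟪G t (u t), ∫ s in t..t', S'.op (s - t) (χ s)⟫_ℝ :=
    ContinuousLinearMap.intervalIntegral_comp_comm (innerSL ℝ (G t (u t))) hq
  rw [intervalIntegral.integral_sub ((i₃.add i₁).mono_Icc h0 h1 h2) (i₂.mono_Icc h0 h1 h2),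
    intervalIntegral.integral_add (i₃.mono_Icc h0 h1 h2) (i₁.mono_Icc h0 h1 h2), e₁, e₂,
    ← hGK t t' h0 h1 h2 (u t) (v t')]
  have hinc := hu.increment hφ h0 h1 h2
  have hinc2 := hv t t' h0 h1 h2
  set r := ∫ s in t..t', S.op (t' - s) (φ s)
  set q := ∫ s in t..t', S'.op (s - t) (χ s)
  have hinc' : S.op (t' - t) (u t) = u t' - r := by rw [hinc]; abel
  have hinc2' : S'.op (t' - t) (v t') = v t - q := by rw [hinc2]; abel
  rw [hinc', hinc2', real_inner_comm _ (v t')]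
  simp only [map_sub, inner_sub_left, inner_sub_right]
  ring

/-- The increments of a mild solution of `G' + G A + A^* G = K`. -/
theorem inner_mild_increment {S S' : C0Semigroup X} (hS' : ∀ t, S'.op t = (S.op t).adjoint)
    {T : ℝ} {G K : ℝ → X →L[ℝ] X} (hK : IsLinftyOp T K)
    (hG : ∀ t ∈ Icc 0 T, ∀ x, G t x = S'.op (T - t) (G T (S.op (T - t) x))
      - ∫ s in t..T, S'.op (s - t) (K s (S.op (s - t) x)))
    {t t' : ℝ} (h0 : 0 ≤ t) (h1 : t ≤ t') (h2 : t' ≤ T) (x w : X) :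
    ⟪G t x, w⟫_ℝ = ⟪G t' (S.op (t' - t) x), S.op (t' - t) w⟫_ℝ
      - ∫ s in t..t', ⟪K s (S.op (s - t) x), S.op (s - t) w⟫_ℝ := by
  have hadj : ∀ t x w, ⟪S'.op t x, w⟫_ℝ = ⟪x, S.op t w⟫_ℝ := fun t x w => by
    rw [hS', ContinuousLinearMap.adjoint_inner_left]
  have hi : ∀ t t' c x, 0 ≤ t → t ≤ t' → t' ≤ T → c ≤ t → IntervalIntegrable
      (fun s => K s (S.op (s - c) x)) volume t t' := fun t t' c x h0 h1 h2 hc =>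
    hK.intervalIntegrable_apply h0 h1 h2
      (S.intervalIntegrable_op_sub_right h1 hc intervalIntegrable_const)
  -- The weak form on `[t,T]` comes from moving `S'` across the inner product. Subtracting its
  -- instance at `t'`, evaluated at `S(t'-t)x` and `S(t'-t)w`, leaves only the integral over
  -- `[t,t']`.
  have hfull : ∀ t, 0 ≤ t → t ≤ T → ∀ x w, ⟪G t x, w⟫_ℝ
      = ⟪G T (S.op (T - t) x), S.op (T - t) w⟫_ℝ
        - ∫ s in t..T, ⟪K s (S.op (s - t) x), S.op (s - t) w⟫_ℝ := by
    intro t h0 h1 x w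
    rw [hG t ⟨h0, h1⟩ x, inner_sub_left, hadj]
    congr 1
    have e := ContinuousLinearMap.intervalIntegral_comp_comm (innerSL ℝ w)
      (S'.intervalIntegrable_op_sub_right h1 le_rfl (hi t T t x h0 h1 le_rfl le_rfl))
    simp only [innerSL_apply_apply] at e
    rw [real_inner_comm, ← e]
    refine intervalIntegral.integral_congr fun s _ => ?_
    rw [real_inner_comm, hadj]
  rw [hfull t h0 (h1.trans h2), hfull t' (h0.trans h1) h2,
    ← S.op_add_apply (sub_nonneg.2 h2) (sub_nonneg.2 h1),
    ← S.op_add_apply (sub_nonneg.2 h2) (sub_nonneg.2 h1), sub_add_sub_cancel, sub_sub]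
  congr 1
  have hii : ∀ a b, t ≤ a → a ≤ b → b ≤ T → IntervalIntegrable
      (fun s => ⟪K s (S.op (s - t) x), S.op (s - t) w⟫_ℝ) volume a b := fun a b ha hab hb =>
    (hi a b t x (h0.trans ha) hab hb ha).inner_continuousOn hab
      ((S.continuousOn_op T w).comp (by fun_prop)
        fun s hs => ⟨by linarith [hs.1], by linarith [hs.2]⟩)
  rw [← intervalIntegral.integral_add_adjacent_intervals (hii t t' le_rfl h1 h2)
    (hii t' T h1 h2 le_rfl), add_comm]
  congr 1
  refine intervalIntegral.integral_congr fun s hs => ?_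
  rw [uIcc_of_le h2] at hs
  rw [← S.op_add_apply (sub_nonneg.2 hs.1) (sub_nonneg.2 h1),
    ← S.op_add_apply (sub_nonneg.2 hs.1) (sub_nonneg.2 h1), sub_add_sub_cancel]

end

/-! ### Time reversal, and increments of the off-diagonal block. -/

section

variable {X : Type*} [NormedAddCommGroup X] [InnerProductSpace ℝ X] [CompleteSpace X]

omit [CompleteSpace X] in
theorem isMildForward_comp_sub_left {S' : C0Semigroup X} {T : ℝ} {χ v : ℝ → X}
    (hvc : ContinuousOn v (Icc 0 T))
    (hv : ∀ t ∈ Icc 0 T, v t = S'.op (T - t) (v T) + ∫ s in t..T, S'.op (s - t) (χ s)) :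
    S'.IsMildForward T (fun t => χ (T - t)) (fun t => v (T - t)) where
  cont := hvc.comp (by fun_prop) fun t ht => ⟨by linarith [ht.2], by linarith [ht.1]⟩
  eq t ht := by
    rw [hv (T - t) ⟨by linarith [ht.2], by linarith [ht.1]⟩, sub_sub_cancel, sub_zero]
    congr 1
    have h := intervalIntegral.integral_comp_sub_left (a := 0) (b := t)
      (fun s => S'.op (s - (T - t)) (χ s)) T
    rw [sub_zero] at h
    rw [← h]
    refine intervalIntegral.integral_congr fun s _ => ?_
    congr 2
    ring

theorem intervalIntegrable_comp_sub_left_self {E : Type*} [NormedAddCommGroup E] {f : ℝ → E}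
    {T : ℝ} (hf : IntervalIntegrable f volume 0 T) :
    IntervalIntegrable (fun s => f (T - s)) volume 0 T := by
  have := (hf.comp_sub_left T).symm
  rwa [sub_zero, sub_self] at this

theorem backward_increment {S' : C0Semigroup X} {T : ℝ} {χ v : ℝ → X}
    (hvc : ContinuousOn v (Icc 0 T)) (hχ : IntervalIntegrable χ volume 0 T)
    (hv : ∀ t ∈ Icc 0 T, v t = S'.op (T - t) (v T) + ∫ s in t..T, S'.op (s - t) (χ s))
    {t t' : ℝ} (h0 : 0 ≤ t) (h1 : t ≤ t') (h2 : t' ≤ T) :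
    v t = S'.op (t' - t) (v t') + ∫ s in t..t', S'.op (s - t) (χ s) := by
  have h := (isMildForward_comp_sub_left hvc hv).increment
    (intervalIntegrable_comp_sub_left_self hχ) (t := T - t') (t' := T - t)
    (by linarith) (by linarith) (by linarith)
  simp only [sub_sub_cancel] at h
  have h' := intervalIntegral.integral_comp_sub_left (a := T - t') (b := T - t)
    (fun s => S'.op (s - t) (χ s)) T
  rw [sub_sub_cancel, sub_sub_cancel] at h'
  rw [h, sub_sub_sub_cancel_left, ← h']
  congr 1
  refine intervalIntegral.integral_congr fun s _ => ?_
  congr 2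
  ring

/-- The identity for `⟪R v, v⟫` when `R' - A R - R A^* + K = 0` and `v' = -A^* v - χ`. -/
theorem quadratic_backward_eq_integral {S S' : C0Semigroup X}
    (hS' : ∀ t, S'.op t = (S.op t).adjoint) {T : ℝ} (hT : 0 < T) {χ v : ℝ → X}
    (hvc : ContinuousOn v (Icc 0 T)) (hχ : IntervalIntegrable χ volume 0 T)
    (hv : ∀ t ∈ Icc 0 T, v t = S'.op (T - t) (v T) + ∫ s in t..T, S'.op (s - t) (χ s))
    {R K : ℝ → X →L[ℝ] X} (hR : IsStronglyContinuousOp T R) (hK : IsLinftyOp T K)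
    (hRK : ∀ t ∈ Icc 0 T, ∀ x, R t x = S.op t (R 0 (S'.op t x))
      - ∫ s in (0 : ℝ)..t, S.op (t - s) (K s (S'.op (t - s) x))) :
    IntervalIntegrable (fun s => ⟪K s (v s), v s⟫_ℝ + ⟪v s, R s (χ s)⟫_ℝ + ⟪R s (v s), χ s⟫_ℝ)
        volume 0 T ∧
      ⟪R 0 (v 0), v 0⟫_ℝ - ⟪R T (v T), v T⟫_ℝ =
        ∫ s in (0 : ℝ)..T, (⟪K s (v s), v s⟫_ℝ + ⟪v s, R s (χ s)⟫_ℝ + ⟪R s (v s), χ s⟫_ℝ) := by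
  have hS : ∀ t, S.op t = (S'.op t).adjoint := fun t => by
    rw [hS', ContinuousLinearMap.adjoint_adjoint]
  -- Under `t ↦ T - t` the equation for `R` becomes one of the type solved by `P`, with `S` and `S'`
  -- exchanged. `T - T` is left unreduced so as to be the reversed family at time `T`.
  have hG : ∀ t ∈ Icc 0 T, ∀ x, R (T - t) x = S.op (T - t) (R (T - T) (S'.op (T - t) x))
      - ∫ s in t..T, S.op (s - t) (K (T - s) (S'.op (s - t) x)) := by
    intro t ht x
    rw [hRK (T - t) ⟨by linarith [ht.2], by linarith [ht.1]⟩, sub_self]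
    congr 1
    have h := intervalIntegral.integral_comp_sub_left (a := t) (b := T)
      (fun s => S.op (T - t - s) (K s (S'.op (T - t - s) x))) T
    rw [sub_self] at h
    rw [← h]
    refine intervalIntegral.integral_congr fun s _ => ?_
    have e : T - t - (T - s) = s - t := by ring
    simp only [e]
  obtain ⟨h1, h2⟩ := quadratic_eq_integral hT (isMildForward_comp_sub_left hvc hv)
    (intervalIntegrable_comp_sub_left_self hχ) (G := fun t => R (T - t)) (K := fun t => K (T - t))
    (fun x => (hR x).comp (by fun_prop)
      fun t ht => ⟨by linarith [ht.2], by linarith [ht.1]⟩) hK.comp_sub_left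
    (fun t t' a b c x w => inner_mild_increment (G := fun t => R (T - t)) hS hK.comp_sub_left hG
      a b c x w)
  constructor
  · simpa only [sub_sub_cancel] using intervalIntegrable_comp_sub_left_self h1
  · have h3 := intervalIntegral.integral_comp_sub_left (a := 0) (b := T)
      (fun s => ⟪K s (v s), v s⟫_ℝ + ⟪v s, R s (χ s)⟫_ℝ + ⟪R s (v s), χ s⟫_ℝ) T
    simp only [sub_self, sub_zero] at h2 h3
    rw [h2, h3]

/-- The increments of the off-diagonal block when `A^* = A`. -/
theorem IsMildSolutionGammaSelfAdjoint.increment {A : X →ₗ.[ℝ] X} {S S' : C0Semigroup X}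
    (hS : S.IsGenerator A) (hS' : ∀ t, S'.op t = (S.op t).adjoint) {T : ℝ}
    {M N Θ Γ : ℝ → X →L[ℝ] X} (h : IsMildSolutionGammaSelfAdjoint A T M N Θ Γ)
    (hK : IsLinftyOp T (fun s => N s * Γ s - Γ s * M s + Θ s)) {t t' : ℝ} (h0 : 0 ≤ t)
    (h1 : t ≤ t') (h2 : t' ≤ T) (x w : X) :
    ⟪Γ t' (S.op (t' - t) x), w⟫_ℝ - ⟪Γ t x, S'.op (t' - t) w⟫_ℝ =
      ∫ s in t..t', ⟪(-(N s * Γ s - Γ s * M s + Θ s)) x, S'.op (t' - t) w⟫_ℝ := by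
  -- Commutation of `Γ(t')` with `A` passes to the semigroup, so `S(t'-t)` can be moved onto `w`;
  -- what remains is the semigroup-free increment of `Γ`.
  have hcomm := S.op_comm_of_gen_comm (G := Γ t') (fun x z hxz => by
    have hxz' := (hS _ _).2 hxz
    obtain ⟨y, rfl, rfl⟩ := (LinearPMap.mem_graph_iff A).1 hxz'
    obtain ⟨hd, hA⟩ := h.comm t' ⟨h0.trans h1, h2⟩ y
    exact (hS _ _).1 ((LinearPMap.mem_graph_iff A).2 ⟨⟨_, hd⟩, rfl, hA⟩)) (sub_nonneg.2 h1) x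
  have hi : ∀ a b, 0 ≤ a → a ≤ b → b ≤ T →
      IntervalIntegrable (fun s => (N s * Γ s - Γ s * M s + Θ s) x) volume a b :=
    fun a b ha hab hb => hK.intervalIntegrable_apply ha hab hb intervalIntegrable_const
  have e1 : Γ t x = Γ t' x + ∫ s in t..t', (N s * Γ s - Γ s * M s + Θ s) x := by
    rw [h.eq t ⟨h0, h1.trans h2⟩, h.eq t' ⟨h0.trans h1, h2⟩,
      ← intervalIntegral.integral_add_adjacent_intervals (hi t t' h0 h1 h2)
        (hi t' T (h0.trans h1) h2 le_rfl)]
    abel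
  have e2 := ContinuousLinearMap.intervalIntegral_comp_comm (innerSL ℝ (S'.op (t' - t) w))
    (hi t t' h0 h1 h2)
  simp only [innerSL_apply_apply] at e2
  have e3 : ⟪S.op (t' - t) (Γ t' x), w⟫_ℝ = ⟪S'.op (t' - t) w, Γ t' x⟫_ℝ := by
    rw [real_inner_comm, hS', ContinuousLinearMap.adjoint_inner_left]
  simp only [neg_apply, real_inner_comm (S'.op (t' - t) w), inner_neg_right,
    intervalIntegral.integral_neg]
  rw [e2, hcomm, e3, e1, inner_add_right]
  ring

/-- The increments of the off-diagonal block when `A^* = -A`. -/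
theorem IsMildSolutionGammaSkewAdjoint.increment {S S' : C0Semigroup X}
    (hS : S.HasScaledAdjoint (-1)) (hS' : ∀ t, S'.op t = (S.op t).adjoint) {T : ℝ}
    {M N Θ Γ : ℝ → X →L[ℝ] X} (h : IsMildSolutionGammaSkewAdjoint S T M N Θ Γ)
    (hK : IsLinftyOp T (fun s => N s * Γ s - Γ s * M s + Θ s)) {t t' : ℝ} (h0 : 0 ≤ t)
    (h1 : t ≤ t') (h2 : t' ≤ T) (x w : X) :
    ⟪Γ t' (S.op (t' - t) x), w⟫_ℝ - ⟪Γ t x, S'.op (t' - t) w⟫_ℝ =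
      ∫ s in t..t', ⟪(-(N s * Γ s - Γ s * M s + Θ s)) (S.op (s - t) x),
        S.op (s - t) (S'.op (t' - t) w)⟫_ℝ := by
  -- Since the inverse of `S` is its adjoint, the equation for `Γ` has the form of that for `P`.
  -- Testing with `S'(t'-t)w` is undone by `S(t'-t)`, which recovers `w`.
  have e1 := inner_mild_increment (G := Γ) hS' hK.neg (fun t ht x => by
    rw [h.eq t ht, C0Semigroup.ringInverse_op hS (sub_nonneg.2 ht.2), hS', sub_eq_add_neg _
      (∫ s in t..T, _), ← intervalIntegral.integral_neg]
    congr 1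
    refine intervalIntegral.integral_congr fun s hs => ?_
    rw [uIcc_of_le ht.2] at hs
    simp only [C0Semigroup.ringInverse_op hS (sub_nonneg.2 hs.1), hS',
      neg_apply, map_neg, neg_neg]) h0 h1 h2 x (S'.op (t' - t) w)
  have e2 : S.op (t' - t) (S'.op (t' - t) w) = w := by
    rw [hS', C0Semigroup.op_adjoint_op hS (sub_nonneg.2 h1)]
  rw [e1, e2]
  ring

@[simp]
theorem blockOp_toLp {X : Type*} [NormedAddCommGroup X] [InnerProductSpace ℝ X]
    (a b c d : X →L[ℝ] X) (x y : X) :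
    blockOp a b c d (WithLp.toLp 2 (x, y)) = WithLp.toLp 2 (a x + b y, c x + d y) := rfl

/-- `⟪Π z, z⟫` for a block operator with symmetric off-diagonal part. -/
theorem inner_blockOp_self (p q g : X →L[ℝ] X) (x y : X) :
    ⟪blockOp p g.adjoint g q (WithLp.toLp 2 (x, y)), WithLp.toLp 2 (x, y)⟫_ℝ
      = ⟪p x, x⟫_ℝ + 2 * ⟪g x, y⟫_ℝ + ⟪q y, y⟫_ℝ := by
  rw [blockOp_toLp, WithLp.prod_inner_apply]
  simp only [inner_add_left, ContinuousLinearMap.adjoint_inner_left]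
  rw [real_inner_comm y]
  ring

end

/-! ### Assembly of the three identities. -/

theorem proposition5p1 {X : Type*} [NormedAddCommGroup X] [InnerProductSpace ℝ X]
    [CompleteSpace X] [TopologicalSpace.SeparableSpace X]
    (A : X →ₗ.[ℝ] X) (S : C0Semigroup X) (hS : S.IsGenerator A)
    (hA : A.adjoint = A ∨ A.adjoint = -A)
    (T : ℝ) (hT : 0 < T)
    (B₁₁ B₁₂ B₂₁ B₂₂ : ℝ → X →L[ℝ] X)
    (hB₁₁ : IsLinftyOp T B₁₁) (hB₁₂ : IsLinftyOp T B₁₂)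
    (hB₂₁ : IsLinftyOp T B₂₁) (hB₂₂ : IsLinftyOp T B₂₂)
    (b₀ g₀ : ℝ → X)
    (hb₀ : IntervalIntegrable b₀ volume 0 T) (hg₀ : IntervalIntegrable g₀ volume 0 T)
    (M N Q₀ R₀ Θ : ℝ → X →L[ℝ] X)
    (hM : IsLinftyOp T M) (hN : IsLinftyOp T N) (hΘ : IsLinftyOp T Θ)
    (hQ₀ : IsLinftyOp T Q₀) (hQ₀s : ∀ t ∈ Icc 0 T, IsSelfAdjoint (Q₀ t))
    (hR₀ : IsLinftyOp T R₀) (hR₀s : ∀ t ∈ Icc 0 T, IsSelfAdjoint (R₀ t))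
    (y ψ : ℝ → X) (hyψ : IsMildSolutionFBEE S T B₁₁ B₁₂ B₂₁ B₂₂ b₀ g₀ y ψ)
    (P R Γ : ℝ → X →L[ℝ] X) (hPi : IsMildSolutionLyapunov A S T M N Q₀ R₀ Θ P R Γ) :
    let BB : ℝ → WithLp 2 (X × X) →L[ℝ] WithLp 2 (X × X) :=
      fun t => blockOp (B₁₁ t) (B₁₂ t) (-B₂₁ t) (-B₂₂ t)
    let MM : ℝ → WithLp 2 (X × X) →L[ℝ] WithLp 2 (X × X) :=
      fun t => blockOp (M t) 0 0 (-(N t).adjoint)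
    let QQ : ℝ → WithLp 2 (X × X) →L[ℝ] WithLp 2 (X × X) :=
      fun t => blockOp (Q₀ t) (Θ t).adjoint (Θ t) (R₀ t)
    let Pi : ℝ → WithLp 2 (X × X) →L[ℝ] WithLp 2 (X × X) :=
      fun t => blockOp (P t) (Γ t).adjoint (Γ t) (R t)
    let z : ℝ → WithLp 2 (X × X) := fun t => WithLp.toLp 2 (y t, ψ t)
    let f : ℝ → WithLp 2 (X × X) := fun t => WithLp.toLp 2 (b₀ t, -g₀ t)
    let integrand : ℝ → ℝ := fun t =>
      ⟪(Pi t * (BB t + MM t) + (BB t + MM t).adjoint * Pi t - QQ t) (z t), z t⟫_ℝ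
        + 2 * ⟪Pi t (f t), z t⟫_ℝ
    IntervalIntegrable integrand volume 0 T ∧
      ⟪Pi T (z T), z T⟫_ℝ - ⟪Pi 0 (z 0), z 0⟫_ℝ = ∫ t in (0 : ℝ)..T, integrand t := by
  intro BB MM QQ Pi z f integrand
  obtain ⟨hP, hR, hΓa, hΓb⟩ := hPi
  have hscaled : S.HasScaledAdjoint 1 ∨ S.HasScaledAdjoint (-1) :=
    hA.imp (C0Semigroup.hasScaledAdjoint_one hS) (C0Semigroup.hasScaledAdjoint_neg_one hS)
  set S' := S.adj (C0Semigroup.tendsto_adjoint_op hscaled)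
  have hS' : ∀ t, S'.op t = (S.op t).adjoint := fun _ => rfl
  have hyi : IntervalIntegrable y volume 0 T :=
    ContinuousOn.intervalIntegrable_of_Icc hT.le hyψ.cont_y
  have hψi : IntervalIntegrable ψ volume 0 T :=
    ContinuousOn.intervalIntegrable_of_Icc hT.le hyψ.cont_ψ
  set φ : ℝ → X := fun s => B₁₁ s (y s) + B₁₂ s (ψ s) + b₀ s with hφdef
  set χ : ℝ → X := fun s => B₂₁ s (y s) + B₂₂ s (ψ s) + g₀ s with hχdef
  have hφ : IntervalIntegrable φ volume 0 T :=
    ((hB₁₁.intervalIntegrable_apply le_rfl hT.le le_rfl hyi).add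
      (hB₁₂.intervalIntegrable_apply le_rfl hT.le le_rfl hψi)).add hb₀
  have hχ : IntervalIntegrable χ volume 0 T :=
    ((hB₂₁.intervalIntegrable_apply le_rfl hT.le le_rfl hyi).add
      (hB₂₂.intervalIntegrable_apply le_rfl hT.le le_rfl hψi)).add hg₀
  have hy : S.IsMildForward T φ y := ⟨hyψ.cont_y, hyψ.forward⟩
  have hKP : IsLinftyOp T (fun s => P s * M s + (M s).adjoint * P s - Q₀ s) :=
    ((hP.cont.isLinftyOp.mul hM).add (hM.adjoint.mul hP.cont.isLinftyOp)).sub hQ₀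
  have hKR : IsLinftyOp T (fun s => R s * (N s).adjoint + N s * R s + R₀ s) :=
    ((hR.cont.isLinftyOp.mul hN.adjoint).add (hN.mul hR.cont.isLinftyOp)).add hR₀
  obtain ⟨iP, eP⟩ := quadratic_eq_integral hT hy hφ hP.cont hKP
    (fun t t' h0 h1 h2 x w => inner_mild_increment hS' hKP hP.eq h0 h1 h2 x w)
  obtain ⟨iR, eR⟩ := quadratic_backward_eq_integral hS' hT hyψ.cont_ψ hχ hyψ.backward hR.cont hKR
    hR.eq
  have hΓ : IntervalIntegrable (fun s => ⟪(-(N s * Γ s - Γ s * M s + Θ s)) (y s), ψ s⟫_ℝ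
        + ⟪ψ s, Γ s (φ s)⟫_ℝ - ⟪Γ s (y s), χ s⟫_ℝ) volume 0 T ∧
      ⟪Γ T (y T), ψ T⟫_ℝ - ⟪Γ 0 (y 0), ψ 0⟫_ℝ =
        ∫ s in (0 : ℝ)..T, (⟪(-(N s * Γ s - Γ s * M s + Θ s)) (y s), ψ s⟫_ℝ
          + ⟪ψ s, Γ s (φ s)⟫_ℝ - ⟪Γ s (y s), χ s⟫_ℝ) := by
    have hv : ∀ t t', 0 ≤ t → t ≤ t' → t' ≤ T →
        ψ t = S'.op (t' - t) (ψ t') + ∫ s in t..t', S'.op (s - t) (χ s) :=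
      fun t t' h0 h1 h2 => backward_increment hyψ.cont_ψ hχ hyψ.backward h0 h1 h2
    have hS31 : ∀ w, ContinuousOn (fun p : ℝ × ℝ × ℝ => S'.op (p.2.2 - p.1) w)
        (timeSimplex T) := fun w => S'.continuousOn_op_apply T (by fun_prop)
      (fun p ⟨a, b, c, d⟩ => ⟨by linarith, by linarith⟩) continuousOn_const
    have hS21 : ∀ {w : ℝ × ℝ × ℝ → X}, ContinuousOn w (timeSimplex T) →
        ContinuousOn (fun p : ℝ × ℝ × ℝ => S.op (p.2.1 - p.1) (w p)) (timeSimplex T) :=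
      fun hw => S.continuousOn_op_apply T (by fun_prop)
        (fun p ⟨a, b, c, d⟩ => ⟨by linarith, by linarith⟩) hw
    rcases hA with hA' | hA'
    · have h := hΓa hA'
      have hK : IsLinftyOp T (fun s => N s * Γ s - Γ s * M s + Θ s) :=
        ((hN.mul h.cont.isLinftyOp).sub (h.cont.isLinftyOp.mul hM)).add hΘ
      exact bilinear_eq_integral hT hy hφ hyψ.cont_ψ hχ hv h.cont hK.neg
        -- The kernels differ between the two cases, but both reduce to the identity on the
        -- diagonal, so the limiting integrand is the same.
        (a := fun _ => ContinuousLinearMap.id ℝ X) (b := fun p => S'.op (p.2.2 - p.1))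
        (fun x => continuousOn_const) (fun s x => rfl) hS31
        (fun s x => by simp only [sub_self, S'.op_zero, ContinuousLinearMap.id_apply])
        (fun t t' h0 h1 h2 x w => h.increment hS hS' hK h0 h1 h2 x w)
    · have h := hΓb hA'
      have hK : IsLinftyOp T (fun s => N s * Γ s - Γ s * M s + Θ s) :=
        ((hN.mul h.cont.isLinftyOp).sub (h.cont.isLinftyOp.mul hM)).add hΘ
      exact bilinear_eq_integral hT hy hφ hyψ.cont_ψ hχ hv h.cont hK.neg
        (a := fun p => S.op (p.2.1 - p.1))
        (b := fun p => (S.op (p.2.1 - p.1)).comp (S'.op (p.2.2 - p.1)))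
        (fun x => hS21 continuousOn_const)
        (fun s x => by simp only [sub_self, S.op_zero, ContinuousLinearMap.id_apply])
        (fun x => hS21 (hS31 x))
        (fun s x => by simp only [sub_self, S.op_zero, S'.op_zero,
          ContinuousLinearMap.comp_apply, ContinuousLinearMap.id_apply])
        (fun t t' h0 h1 h2 x w =>
          h.increment (C0Semigroup.hasScaledAdjoint_neg_one hS hA') hS' hK h0 h1 h2 x w)
  obtain ⟨iΓ, eΓ⟩ := hΓ
  -- The cross term occurs twice by symmetry of `Π`; the identity for `R` was obtained with time
  -- reversed and therefore enters with a minus sign.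
  have hint := (iP.add (iΓ.const_mul 2)).sub iR
  have hpt : ∀ s ∈ Icc 0 T, integrand s
      = (⟪(P s * M s + (M s).adjoint * P s - Q₀ s) (y s), y s⟫_ℝ + ⟪y s, P s (φ s)⟫_ℝ
          + ⟪P s (y s), φ s⟫_ℝ)
        + 2 * (⟪(-(N s * Γ s - Γ s * M s + Θ s)) (y s), ψ s⟫_ℝ + ⟪ψ s, Γ s (φ s)⟫_ℝ
          - ⟪Γ s (y s), χ s⟫_ℝ)
        - (⟪(R s * (N s).adjoint + N s * R s + R₀ s) (ψ s), ψ s⟫_ℝ + ⟪ψ s, R s (χ s)⟫_ℝ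
          + ⟪R s (ψ s), χ s⟫_ℝ) := by
    intro s hs
    -- Self-adjointness of `P(s)` and `R(s)` lets every pairing be brought to one orientation, after
    -- which the claim is a polynomial identity.
    have sP : ∀ a b, ⟪P s a, b⟫_ℝ = ⟪P s b, a⟫_ℝ := fun a b => by
      rw [(hP.selfAdjoint s hs).isSymmetric.apply_clm a b, real_inner_comm]
    have sR : ∀ a b, ⟪R s a, b⟫_ℝ = ⟪R s b, a⟫_ℝ := fun a b => by
      rw [(hR.selfAdjoint s hs).isSymmetric.apply_clm a b, real_inner_comm]
    simp only [integrand, BB, MM, QQ, Pi, z, f, hφdef, hχdef, sub_apply, add_apply, neg_apply,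
      mul_apply_eq_comp, inner_add_left, inner_sub_left,
      ContinuousLinearMap.adjoint_inner_left, blockOp_toLp, ← WithLp.toLp_add, Prod.mk_add_mk,
      WithLp.prod_inner_apply, map_add, map_neg, inner_add_right, inner_neg_left,
      inner_neg_right, zero_apply, zero_add, add_zero]
    have cψ : ∀ a, ⟪ψ s, a⟫_ℝ = ⟪a, ψ s⟫_ℝ := fun a => real_inner_comm _ _
    have cy : ∀ a, ⟪y s, a⟫_ℝ = ⟪a, y s⟫_ℝ := fun a => real_inner_comm _ _
    have cΓ : ∀ a, ⟪a, Γ s (y s)⟫_ℝ = ⟪Γ s (y s), a⟫_ℝ := fun a => real_inner_comm _ _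
    simp only [cψ, cy, cΓ, sP _ (y s), sR _ (ψ s), ContinuousLinearMap.adjoint_inner_right]
    ring
  have hIcc : EqOn integrand _ (uIcc 0 T) := fun s hs => hpt s (by rwa [uIcc_of_le hT.le] at hs)
  refine ⟨hint.congr fun s hs => (hIcc (uIoc_subset_uIcc hs)).symm, ?_⟩
  rw [intervalIntegral.integral_congr hIcc, intervalIntegral.integral_sub
    (iP.add (iΓ.const_mul 2)) iR, intervalIntegral.integral_add iP (iΓ.const_mul 2),
    intervalIntegral.integral_const_mul, ← eP, ← eR, ← eΓ]
  simp only [Pi, z, inner_blockOp_self]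
  ring
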